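/- Let $A,B\in\mathbb R$, $\mathcal H=L^2(\mathbb R^2)$ with inner product $\langle f,g\rangle=\int\overline f g$, and let $\mathcal D=\mathcal S(\mathbb R^2)$ be the Schwartz space. Let $x_j$ and $p_j=-i\partial_j$ ($j=1,2$) be the self-adjoint position and momentum operators and $$H=\tfrac12(p_1^2+x_1^2)+\tfrac12(p_2^2+x_2^2)+i[A(x_1+x_2)+B(p_1+p_2)].$$ Put $C=iA-B$, $D=iA+B$, $a_j=\frac1{\sqrt2}(x_j+ip_j+C)$, $b_j=\frac1{\sqrt2}(x_j-ip_j+D)$, $N_j=b_ja_j$, $c_j=\frac1{\sqrt2}(x_j+ip_j)$ (with natural domains; $\dagger$ denotes the Hilbert space adjoint). (1) The operators $a_j,b_j$ are $\mathcal D$-pseudo-bosonic: $\mathcal D$ is dense in $\mathcal H$ and stable under $a_j,b_j,a_j^\dagger,b_j^\dagger$, and $[a_j,b_k]f=\delta_{jk}f$, $[a_j,a_k]f=[b_j,b_k]f=0$ for all $f\in\mathcal D$. Constants $N,N'\in\mathbb C$ with $\langle\varphi_{0,0},\Psi_{0,0}\rangle=1$ exist, where $\varphi_{0,0}=Ne^{-\frac12(x_1^2+x_2^2)-C(x_1+x_2)}$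 and $\Psi_{0,0}=N'e^{-\frac12(x_1^2+x_2^2)-\overline D(x_1+x_2)}$. For all such constants, $\varphi_{0,0}$ and $\Psi_{0,0}$ are non-zero elements of $\mathcal D$ with $a_j\varphi_{0,0}=0$, $b_j^\dagger\Psi_{0,0}=0$, and the vectors $\varphi_{n}=\frac{1}{\sqrt{n_1!n_2!}}b_1^{n_1}b_2^{n_2}\varphi_{0,0}$ and $\Psi_{n}=\frac{1}{\sqrt{n_1!n_2!}}(a_1^\dagger)^{n_1}(a_2^\dagger)^{n_2}\Psi_{0,0}$, $n=(n_1,n_2)\in\mathbb N_0^2$, lie in $\mathcal D$. (2) $Hf=(N_1+N_2+(A^2+B^2+1))f$ for all $f\in\mathcal D$. (3) Let $\Phi_{0,0}=\pi^{-1/2}e^{-\frac12(x_1^2+x_2^2)}$ and $\Phi_n=\frac{1}{\sqrt{n_1!n_2!}}(c_1^\dagger)^{n_1}(c_2^\dagger)^{n_2}\Phi_{0,0}$. Then $c_j\Phi_{0,0}=0$ and $(\Phi_n)$ is an orthonormal basis of $\mathcal H$. The closure of $-A(p_1+p_2)+B(x_1+x_2)$ is self-adjoint, and its exponential $T=e^{-A(p_1+p_2)+B(x_1+x_2)}$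 in the sense of the functional calculus is a well-defined self-adjoint, injective operator with dense range, unbounded if $(A,B)\neq(0,0)$. All $\Phi_n$ lie in $D(T)\cap D(T^{-1})$, and for a suitable choice of $N,N'$ with $\langle\varphi_{0,0},\Psi_{0,0}\rangle=1$ one has $\varphi_n=T\Phi_n$ and $\Psi_n=T^{-1}\Phi_n$ for all $n$. (4) For all $N,N'$ with $\langle\varphi_{0,0},\Psi_{0,0}\rangle=1$, the families $(\varphi_n)$ and $(\Psi_n)$ are $\mathcal G$-quasi bases for $\mathcal G=D(T)\cap D(T^{-1})$: $\mathcal G$ is dense, contains all $\varphi_n,\Psi_n$, and for all $f,g\in\mathcal G$ $$\langle f,g\rangle=\sum_n\langle f,\varphi_n\rangle\langle\Psi_n,g\rangle=\sum_n\langle f,\Psi_n\rangle\langle\varphi_n,g\rangle .$$ (5) Let $\Theta=T^{-2}$. Then $\Theta=e^{2A(p_1+p_2)-2B(x_1+x_2)}$ is self-adjoint and injective, and $\Psi_n=\Theta\varphi_n$ for all $n$, with $N,N'$ as chosen in (3). For every $f\in\mathcal D\cap D(\Theta)$ with $\Theta f\in\mathcal D$ one has $a_jf=\Theta^{-1}b_j^\dagger\Theta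 f$ and $N_jf=\Theta^{-1}N_j^\dagger\Theta f$. Moreover there is a dense subspace $\mathcal D_0\subseteq\mathcal D$ that contains all $\varphi_n$ and $\Psi_n$ (for all $N,N'$), is stable under $a_j,b_j,a_j^\dagger,b_j^\dagger,\Theta,\Theta^{-1}$, and on which therefore $(a_j,b_j)$ are $\mathcal D_0$-pseudo-bosonic and $a_j=\Theta^{-1}b_j^\dagger\Theta$, i.e. $(a_j,b_j^\dagger)$ are $\Theta$-conjugate. -/

import Mathlib

open MeasureTheory
open scoped SchwartzMap LinearPMap LineDeriv

noncomputable section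

namespace PB

/-! ### Unbounded operators on a complex Hilbert space -/

section Operators

variable {E : Type*} [NormedAddCommGroup E] [InnerProductSpace ℂ E]

/-- The product `L M` of two unbounded operators, with its natural domain
`{f ∈ D(M) : M f ∈ D(L)}`. -/
def opMul (L M : E →ₗ.[ℂ] E) : E →ₗ.[ℂ] E where
  domain := (L.domain.comap M.toFun).map M.domain.subtype
  toFun :=
    { toFun := fun x => L ⟨M ⟨x.1, by
          obtain ⟨y, -, hxy⟩ := x.2
          exact hxy ▸ y.2⟩, by
          obtain ⟨x, y, hy, rfl⟩ := x
          exact hy⟩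
      map_add' := fun x y => by
        rw [← L.map_add]
        congr 1
        apply Subtype.ext
        exact M.map_add ⟨x.1, _⟩ ⟨y.1, _⟩
      map_smul' := fun c x => by
        rw [RingHom.id_apply, ← L.map_smul]
        congr 1
        apply Subtype.ext
        exact M.map_smul c ⟨x.1, _⟩ }

/-- The everywhere defined operator `c 𝟙`. -/
def scalarOp (c : ℂ) : E →ₗ.[ℂ] E := (c • LinearMap.id : E →ₗ[ℂ] E).toPMap ⊤

open Classical in
/-- `L f` for `f ∈ D(L)`, extended by `0` outside `D(L)`. -/
def app (L : E →ₗ.[ℂ] E) (f : E) : E :=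
  if h : f ∈ L.domain then L ⟨f, h⟩ else 0

/-- `𝒟 ⊆ D(L)` and `L 𝒟 ⊆ 𝒟`. -/
def StableUnder (𝒟 : Submodule ℂ E) (L : E →ₗ.[ℂ] E) : Prop :=
  ∀ f ∈ 𝒟, ∃ g ∈ 𝒟, (f, g) ∈ L.graph

variable [CompleteSpace E]

/-- The families `(a j)`, `(b j)` are `𝒟`-pseudo-bosonic: `𝒟` is dense and stable under all `a j`,
`b j` and their adjoints, and `[a j, b k] f = δ_{jk} f`, `[a j, a k] f = [b j, b k] f = 0` for all
`f ∈ 𝒟`. -/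
structure IsPseudoBosonic {ι : Type*} [DecidableEq ι] (𝒟 : Submodule ℂ E)
    (a b : ι → (E →ₗ.[ℂ] E)) : Prop where
  dense : Dense (𝒟 : Set E)
  stable_a : ∀ j, StableUnder 𝒟 (a j)
  stable_b : ∀ j, StableUnder 𝒟 (b j)
  stable_a_adj : ∀ j, StableUnder 𝒟 (a j)†
  stable_b_adj : ∀ j, StableUnder 𝒟 (b j)†
  comm_ab : ∀ j k, ∀ f ∈ 𝒟,
    (f, if j = k then f else 0) ∈ (opMul (a j) (b k) - opMul (b k) (a j)).graph
  comm_aa : ∀ j k, ∀ f ∈ 𝒟, (f, 0) ∈ (opMul (a j) (a k) - opMul (a k) (a j)).graph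
  comm_bb : ∀ j k, ∀ f ∈ 𝒟, (f, 0) ∈ (opMul (b j) (b k) - opMul (b k) (b j)).graph

/-- The families `φ`, `ψ` are `𝒢`-quasi bases: `𝒢` is a dense subspace containing both families,
and `⟨f,g⟩ = ∑ₙ ⟨f,φₙ⟩⟨ψₙ,g⟩ = ∑ₙ ⟨f,ψₙ⟩⟨φₙ,g⟩` for all `f, g ∈ 𝒢`. -/
structure IsQuasiBases {ι : Type*} (𝒢 : Submodule ℂ E) (φ ψ : ι → E) : Prop where
  dense : Dense (𝒢 : Set E)
  mem_left : ∀ n, φ n ∈ 𝒢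
  mem_right : ∀ n, ψ n ∈ 𝒢
  hasSum_left : ∀ f ∈ 𝒢, ∀ g ∈ 𝒢,
    HasSum (fun n => inner ℂ f (φ n) * inner ℂ (ψ n) g) (inner ℂ f g)
  hasSum_right : ∀ f ∈ 𝒢, ∀ g ∈ 𝒢,
    HasSum (fun n => inner ℂ f (ψ n) * inner ℂ (φ n) g) (inner ℂ f g)

/-- `L f = Θ⁻¹ M Θ f`, both sides being defined. -/
def Intertwines (Θ L M : E →ₗ.[ℂ] E) (f : E) : Prop :=
  ∃ h, (f, h) ∈ L.graph ∧ (f, h) ∈ (opMul Θ.inverse (opMul M Θ)).graph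

/-- `(a, c)` are `Θ`-conjugate on `𝒟`: `Θ` is self-adjoint and invertible, `Θ` and `Θ⁻¹` leave `𝒟`
invariant, and `a f = Θ⁻¹ c Θ f` for all `f ∈ 𝒟`. -/
structure IsConjugate (𝒟 : Submodule ℂ E) (Θ a c : E →ₗ.[ℂ] E) : Prop where
  selfAdjoint : IsSelfAdjoint Θ
  injective : LinearMap.ker Θ.toFun = ⊥
  stable : StableUnder 𝒟 Θ
  stable_inv : StableUnder 𝒟 Θ.inverse
  conj : ∀ f ∈ 𝒟, Intertwines Θ a c f

end Operators

/-! ### Functional calculus of self-adjoint operators -/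

/-- The maximal operator of multiplication by the real function `g` in `L²(μ)`, with domain
`{f ∈ L² : g f ∈ L²}`. -/
def mulOp {α : Type*} [MeasurableSpace α] (μ : Measure α) (g : α → ℝ) :
    Lp ℂ 2 μ →ₗ.[ℂ] Lp ℂ 2 μ where
  domain :=
    { carrier := {f | MemLp (fun x => (g x : ℂ) * f x) 2 μ}
      add_mem' := by
        intro f h hf hh
        refine (memLp_congr_ae ?_).mp (MemLp.add hf hh)
        filter_upwards [Lp.coeFn_add f h] with x hx
        simp only [hx, Pi.add_apply]
        ring
      zero_mem' := by
        refine (memLp_congr_ae ?_).mp (MemLp.zero (ε := ℂ) (p := 2) (μ := μ))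
        filter_upwards [Lp.coeFn_zero ℂ 2 μ] with x hx
        simp only [hx, Pi.zero_apply, mul_zero]
      smul_mem' := by
        intro c f hf
        refine (memLp_congr_ae ?_).mp (MemLp.const_smul hf c)
        filter_upwards [Lp.coeFn_smul c f] with x hx
        simp only [hx, Pi.smul_apply, smul_eq_mul]
        ring }
  toFun :=
    { toFun := fun f => MemLp.toLp _ f.2
      map_add' := by
        intro f h
        rw [← MemLp.toLp_add]
        refine MemLp.toLp_congr _ _ ?_
        filter_upwards [Lp.coeFn_add f.1 h.1] with x hx
        simp only [Submodule.coe_add, hx, Pi.add_apply]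
        ring
      map_smul' := by
        intro c f
        rw [RingHom.id_apply, ← MemLp.toLp_const_smul]
        refine MemLp.toLp_congr _ _ ?_
        filter_upwards [Lp.coeFn_smul c f.1] with x hx
        simp only [Submodule.coe_smul, hx, Pi.smul_apply, smul_eq_mul]
        ring }

/-- `S = F(K)` in the sense of the functional calculus of self-adjoint operators: a unitary map
onto some `L²(μ)` turns `K` into multiplication by a real measurable function `g` and `S` into
multiplication by `F ∘ g`. In particular `K` is self-adjoint. -/
def IsFunctionOf {E : Type*} [NormedAddCommGroup E] [InnerProductSpace ℂ E]
    (F : ℝ → ℝ) (K S : E →ₗ.[ℂ] E) : Prop :=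
  ∃ (α : Type) (_ : MeasurableSpace α) (μ : Measure α) (_ : SigmaFinite μ) (g : α → ℝ)
    (U : E ≃ₗᵢ[ℂ] Lp ℂ 2 μ), Measurable g ∧
    (∀ f h, (f, h) ∈ K.graph ↔ (U f, U h) ∈ (mulOp μ g).graph) ∧
    (∀ f h, (f, h) ∈ S.graph ↔ (U f, U h) ∈ (mulOp μ (fun y => F (g y))).graph)

/-! ### Position and momentum in `L²(ℝ²)` -/

/-- The plane `ℝ²`. -/
abbrev Plane : Type := EuclideanSpace ℝ (Fin 2)

/-- The Hilbert space `L²(ℝ²)`. -/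
abbrev Hil : Type := Lp ℂ 2 (volume : Measure Plane)

/-- The embedding of `𝒮(ℝ²)` in `L²(ℝ²)`. -/
def embed : 𝓢(Plane, ℂ) →ₗ[ℂ] Hil :=
  (SchwartzMap.toLpCLM ℂ ℂ 2 (volume : Measure Plane)).toLinearMap

theorem embed_injective : Function.Injective embed :=
  SchwartzMap.injective_toLp 2 (volume : Measure Plane)

/-- `𝒮(ℝ²)` as a subspace of `L²(ℝ²)`. -/
def schwartz : Submodule ℂ Hil := LinearMap.range embed

/-- The operator in `L²(ℝ²)` with domain `𝒮(ℝ²)` given by a linear map of `𝒮(ℝ²)`. -/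
def ofSchwartz (L : 𝓢(Plane, ℂ) →ₗ[ℂ] 𝓢(Plane, ℂ)) : Hil →ₗ.[ℂ] Hil where
  domain := schwartz
  toFun := embed ∘ₗ L ∘ₗ (LinearEquiv.ofInjective embed embed_injective).symm.toLinearMap

/-- The self-adjoint position operator `x_j`. -/
def xOp (j : Fin 2) : Hil →ₗ.[ℂ] Hil := mulOp volume (fun y : Plane => y j)

/-- The self-adjoint momentum operator `p_j`, the closure of `-i ∂_j` on `𝒮(ℝ²)`. -/
def pOp (j : Fin 2) : Hil →ₗ.[ℂ] Hil :=
  (ofSchwartz (-Complex.I •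
    (LineDeriv.lineDerivOpCLM ℂ 𝓢(Plane, ℂ) (EuclideanSpace.single j (1 : ℝ))).toLinearMap)).closure

/-! ### The model -/

/-- `H = ½(p₁²+x₁²) + ½(p₂²+x₂²) + i[A(x₁+x₂) + B(p₁+p₂)]`. -/
def hamiltonian (A B : ℝ) : Hil →ₗ.[ℂ] Hil :=
  (1 / 2 : ℂ) • (opMul (pOp 0) (pOp 0) + opMul (xOp 0) (xOp 0)) +
  (1 / 2 : ℂ) • (opMul (pOp 1) (pOp 1) + opMul (xOp 1) (xOp 1)) +
  Complex.I • ((A : ℂ) • (xOp 0 + xOp 1) + (B : ℂ) • (pOp 0 + pOp 1))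

/-- `C = iA - B`. -/
def constC (A B : ℝ) : ℂ := Complex.I * A - B

/-- `D = iA + B`. -/
def constD (A B : ℝ) : ℂ := Complex.I * A + B

/-- `a_j = (x_j + i p_j + C)/√2`. -/
def aOp (A B : ℝ) (j : Fin 2) : Hil →ₗ.[ℂ] Hil :=
  (1 / (√2 : ℝ) : ℂ) • (xOp j + Complex.I • pOp j + scalarOp (constC A B))

/-- `b_j = (x_j - i p_j + D)/√2`. -/
def bOp (A B : ℝ) (j : Fin 2) : Hil →ₗ.[ℂ] Hil :=
  (1 / (√2 : ℝ) : ℂ) • (xOp j - Complex.I • pOp j + scalarOp (constD A B))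

/-- `N_j = b_j a_j`. -/
def num (A B : ℝ) (j : Fin 2) : Hil →ₗ.[ℂ] Hil := opMul (bOp A B j) (aOp A B j)

/-- The bosonic operator `c_j = (x_j + i p_j)/√2`. -/
def cOp (j : Fin 2) : Hil →ₗ.[ℂ] Hil := (1 / (√2 : ℝ) : ℂ) • (xOp j + Complex.I • pOp j)

/-- The function `N exp(-½(x₁²+x₂²) - k(x₁+x₂))`. -/
def gaussFun (N k : ℂ) (y : Plane) : ℂ :=
  N * Complex.exp (-(1 / 2 : ℂ) * ((y 0 : ℂ) ^ 2 + (y 1 : ℂ) ^ 2) - k * ((y 0 : ℂ) + (y 1 : ℂ)))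

theorem memLp_gaussFun (N k : ℂ) : MemLp (gaussFun N k) 2 (volume : Measure Plane) := by
  have hcont : Continuous (gaussFun N k) := by
    unfold gaussFun
    fun_prop
  rw [memLp_two_iff_integrable_sq_norm hcont.aestronglyMeasurable]
  have h := (GaussianFourier.integrable_cexp_neg_mul_sq_norm_add (V := Plane) (b := 1) (by simp)
    (-2 * (k.re : ℂ)) (!₂[1, 1] : Plane)).norm.const_mul (‖N‖ ^ 2)
  refine h.congr (Filter.Eventually.of_forall fun y => ?_)
  have hre (r : ℝ) : ((r : ℂ) ^ 2).re = r ^ 2 := by rw [← Complex.ofReal_pow, Complex.ofReal_re]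
  have hn : ‖y‖ ^ 2 = y 0 ^ 2 + y 1 ^ 2 := by
    rw [EuclideanSpace.real_norm_sq_eq, Fin.sum_univ_two]
  simp only [gaussFun, norm_mul, mul_pow, Complex.norm_exp, ← Real.exp_nat_mul]
  congr 2
  simp [hre, hn, PiLp.inner_apply, Fin.sum_univ_two]
  ring

/-- The element of `L²(ℝ²)` given by `N exp(-½(x₁²+x₂²) - k(x₁+x₂))`. -/
def gauss (N k : ℂ) : Hil := (memLp_gaussFun N k).toLp _

/-- `(n₁! n₂!)^{-1/2} L₁^{n₁} L₂^{n₂} v`. -/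
def tower (L : Fin 2 → (Hil →ₗ.[ℂ] Hil)) (v : Hil) (n : ℕ × ℕ) : Hil :=
  (1 / (√(n.1.factorial * n.2.factorial) : ℝ) : ℂ) • (app (L 0))^[n.1] ((app (L 1))^[n.2] v)

/-- `φ_n = (n₁! n₂!)^{-1/2} b₁^{n₁} b₂^{n₂} φ_{0,0}`, `φ_{0,0} = N e^{-½(x₁²+x₂²) - C(x₁+x₂)}`. -/
def phi (A B : ℝ) (N : ℂ) : ℕ × ℕ → Hil := tower (bOp A B) (gauss N (constC A B))

/-- `Ψ_n = (n₁! n₂!)^{-1/2} (a₁†)^{n₁} (a₂†)^{n₂} Ψ_{0,0}`,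
`Ψ_{0,0} = N' e^{-½(x₁²+x₂²) - D̄(x₁+x₂)}`. -/
def psi (A B : ℝ) (N' : ℂ) : ℕ × ℕ → Hil :=
  tower (fun j => (aOp A B j)†) (gauss N' (starRingEnd ℂ (constD A B)))

/-- The oscillator eigenfunctions `Φ_n = (n₁! n₂!)^{-1/2} (c₁†)^{n₁} (c₂†)^{n₂} Φ_{0,0}`,
`Φ_{0,0} = π^{-1/2} e^{-½(x₁²+x₂²)}`. -/
def bigPhi : ℕ × ℕ → Hil := tower (fun j => (cOp j)†) (gauss (1 / (√Real.pi : ℝ) : ℂ) 0)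

/-- The closure of `-A(p₁+p₂) + B(x₁+x₂)`. -/
def generator (A B : ℝ) : Hil →ₗ.[ℂ] Hil :=
  ((-A : ℂ) • (pOp 0 + pOp 1) + (B : ℂ) • (xOp 0 + xOp 1)).closure

end PB

end

open PB

noncomputable section

namespace PB

/-! ### Graph calculus for unbounded operators -/

section Graphs

variable {E : Type*} [NormedAddCommGroup E] [InnerProductSpace ℂ E]

/-! Write K for the closure of -A(p₁+p₂) + B(x₁+x₂). Formally e^{tK} x_j e^{-tK} = x_j + t·iA and
e^{tK} p_j e^{-tK} = p_j + t·iB. Since iA + i(iB) = C and iA - i(iB) = D, conjugation by e^{tK}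
carries (x_j + ip_j + sC)/√2 to the same expression with s + t in place of s, and likewise (x_j -
ip_j + sD)/√2. These are `lo` and `hi`. The relation C̄ = -D gives all operators of the model at
three values of s: a and b at s = 1, c and c† at s = 0, b† and a† at s = -1. Hence T = e^{K} carries
the oscillator to (a, b), T⁻¹ carries it to (b†, a†), and Θ = e^{-2K} relates a to b†.

To make this rigorous, K is diagonalised on Schwartz space (`Diagonalization`). A unitary map U
preserving 𝒮(ℝ²) turns K into multiplication by c(y₁+y₂): the identity if A = 0, otherwise a chirp
that removes the B-term, followed by the Fourier transform. Self-adjointness of K reduces to 𝒮 being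
a core of this multiplication operator (`mem_closure_schwartz_graph`). The exponentials become
multiplications by e^{tc(y₁+y₂)}, and commuting these past ∂_j yields the shifts above
(`mem_graph_expOp_lo`, `mem_graph_expOp_hi`).

The image of the oscillator vacuum under U is a Gaussian exp(-z|y|²/2) with Re z > 0 up to a factor,
so it stays Schwartz after multiplication by e^{tc(y₁+y₂)}. The resulting vector is annihilated by
`lo` at shift t, hence is a multiple of the explicit vacuum at that shift
(`exists_mem_graph_expOp_vac`). Applying raising operators gives φ_n = TΦ_n and Ψ_n = T⁻¹Φ_n. The
quasi-basis identities are then Parseval for Φ_n applied to Tf and T⁻¹g. The space 𝒟₀ consists of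
the Schwartz functions that every e^{tK} keeps Schwartz (`invS`). It is dense because it contains
the orthonormal basis Φ_n, whose completeness is a Fourier argument
(`eq_zero_of_inner_hermiteSpan`).

Unbounded operators are handled through their graphs, which keeps domain conditions out of the
algebra. The functional calculus exponential is shown not to depend on the chosen spectral
representation (`IsFunctionOf.exp_unique`). -/

theorem mem_graph_add_iff {L M : E →ₗ.[ℂ] E} {f k : E} :
    (f, k) ∈ (L + M).graph ↔ ∃ g h, (f, g) ∈ L.graph ∧ (f, h) ∈ M.graph ∧ g + h = k := by
  constructor
  · intro h
    obtain ⟨⟨x, hx⟩, hxf, hxk⟩ := (LinearPMap.mem_graph_iff _).1 h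
    simp only at hxf hxk
    subst hxf
    exact ⟨_, _, L.mem_graph ⟨x, hx.1⟩, M.mem_graph ⟨x, hx.2⟩, hxk⟩
  · rintro ⟨g, h, hg, hh, rfl⟩
    obtain ⟨⟨x, hx⟩, hxf, hxk⟩ := (LinearPMap.mem_graph_iff _).1 hg
    obtain ⟨⟨y, hy⟩, hyf, hyk⟩ := (LinearPMap.mem_graph_iff _).1 hh
    simp only at hxf hxk hyf hyk
    subst hxf hyf hxk hyk
    exact (L + M).mem_graph ⟨y, hx, hy⟩

theorem mem_graph_sub {L M : E →ₗ.[ℂ] E} {f g h : E} (hg : (f, g) ∈ L.graph)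
    (hh : (f, h) ∈ M.graph) : (f, g - h) ∈ (L - M).graph := by
  obtain ⟨⟨x, hx⟩, hxf, hxk⟩ := (LinearPMap.mem_graph_iff _).1 hg
  obtain ⟨⟨y, hy⟩, hyf, hyk⟩ := (LinearPMap.mem_graph_iff _).1 hh
  simp only at hxf hxk hyf hyk
  subst hxf hyf hxk hyk
  exact (L - M).mem_graph ⟨y, hx, hy⟩

theorem mem_graph_add {L M : E →ₗ.[ℂ] E} {f g h : E} (hg : (f, g) ∈ L.graph)
    (hh : (f, h) ∈ M.graph) : (f, g + h) ∈ (L + M).graph :=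
  mem_graph_add_iff.2 ⟨g, h, hg, hh, rfl⟩

theorem exists_of_mem_graph_sub {L M : E →ₗ.[ℂ] E} {f k : E} (h : (f, k) ∈ (L - M).graph) :
    ∃ g h, (f, g) ∈ L.graph ∧ (f, h) ∈ M.graph ∧ g - h = k := by
  obtain ⟨⟨x, hx⟩, hxf, hxk⟩ := (LinearPMap.mem_graph_iff _).1 h
  simp only at hxf hxk
  subst hxf
  exact ⟨_, _, L.mem_graph ⟨x, hx.1⟩, M.mem_graph ⟨x, hx.2⟩, hxk⟩

theorem mem_graph_smul {L : E →ₗ.[ℂ] E} {f g : E} (c : ℂ) (hg : (f, g) ∈ L.graph) :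
    (f, c • g) ∈ (c • L).graph := by
  obtain ⟨⟨x, hx⟩, hxf, hxk⟩ := (LinearPMap.mem_graph_iff _).1 hg
  simp only at hxf hxk
  subst hxf hxk
  exact (c • L).mem_graph ⟨x, hx⟩

theorem exists_of_mem_graph_smul {L : E →ₗ.[ℂ] E} {c : ℂ} {f k : E}
    (h : (f, k) ∈ (c • L).graph) : ∃ g, (f, g) ∈ L.graph ∧ c • g = k := by
  obtain ⟨⟨x, hx⟩, hxf, hxk⟩ := (LinearPMap.mem_graph_iff _).1 h
  simp only at hxf hxk
  subst hxf
  exact ⟨_, L.mem_graph ⟨x, hx⟩, hxk⟩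

theorem mem_graph_scalarOp_iff {c : ℂ} {f g : E} :
    (f, g) ∈ (scalarOp c : E →ₗ.[ℂ] E).graph ↔ g = c • f := by
  rw [LinearPMap.mem_graph_iff]
  constructor
  · rintro ⟨⟨x, hx⟩, hxf, hxk⟩
    simp only at hxf hxk
    subst hxf
    exact hxk.symm
  · rintro rfl
    exact ⟨⟨f, trivial⟩, rfl, rfl⟩

theorem mem_graph_opMul_iff {L M : E →ₗ.[ℂ] E} {f k : E} :
    (f, k) ∈ (opMul L M).graph ↔ ∃ g, (f, g) ∈ M.graph ∧ (g, k) ∈ L.graph := by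
  constructor
  · intro h
    obtain ⟨⟨x, y, hy, hyx⟩, hxf, hxk⟩ := (LinearPMap.mem_graph_iff _).1 h
    simp only at hxf hxk
    subst hxf hyx
    refine ⟨M y, M.mem_graph y, ?_⟩
    rw [← hxk]
    exact L.mem_graph ⟨M y, hy⟩
  · rintro ⟨g, hg, hk⟩
    obtain ⟨x, hxf, hxk⟩ := (LinearPMap.mem_graph_iff _).1 hg
    obtain ⟨y, hyf, hyk⟩ := (LinearPMap.mem_graph_iff _).1 hk
    simp only at hxf hxk hyf hyk
    subst hxf hxk hyk
    have hy : M x ∈ L.domain := hyf ▸ y.2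
    have hmem : (x : E) ∈ (opMul L M).domain := ⟨x, hy, rfl⟩
    have : opMul L M ⟨x, hmem⟩ = L y := congrArg L (Subtype.ext hyf.symm)
    rw [← this]
    exact (opMul L M).mem_graph ⟨x, hmem⟩

theorem mem_graph_inverse_iff {L : E →ₗ.[ℂ] E} (hL : LinearMap.ker L.toFun = ⊥) {f g : E} :
    (f, g) ∈ L.inverse.graph ↔ (g, f) ∈ L.graph := by
  rw [LinearPMap.inverse_graph hL]
  simp

theorem ker_eq_bot_of_graph {L : E →ₗ.[ℂ] E} (h : ∀ f, (f, 0) ∈ L.graph → f = 0) :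
    LinearMap.ker L.toFun = ⊥ := by
  rw [LinearMap.ker_eq_bot']
  intro x hx
  have := L.mem_graph x
  rw [← LinearPMap.toFun_eq_coe, hx] at this
  exact Subtype.ext (h _ this)

theorem app_eq_of_mem_graph {L : E →ₗ.[ℂ] E} {f g : E} (h : (f, g) ∈ L.graph) : app L f = g := by
  have hf := LinearPMap.mem_domain_of_mem_graph h
  rw [app, dif_pos hf]
  exact ((LinearPMap.image_iff hf).2 h).symm

theorem graph_ext {L M : E →ₗ.[ℂ] E} (h : ∀ f g, (f, g) ∈ L.graph ↔ (f, g) ∈ M.graph) : L = M :=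
  LinearPMap.eq_of_eq_graph (SetLike.ext fun ⟨f, g⟩ => h f g)

/-- Elements of the graph of the closure satisfy every closed relation satisfied by the graph. -/
theorem inner_eq_of_mem_graph_closure {L : E →ₗ.[ℂ] E} (hL : L.IsClosable) {f g : E}
    (h : ∀ u v, (u, v) ∈ L.graph → inner ℂ v f = inner ℂ u g) {u v : E}
    (huv : (u, v) ∈ L.closure.graph) : inner ℂ v f = inner ℂ u g := by
  rw [← hL.graph_closure_eq_closure_graph] at huv
  have hc : IsClosed {p : E × E | inner ℂ p.2 f = inner ℂ p.1 g} :=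
    isClosed_eq (by fun_prop) (by fun_prop)
  exact closure_minimal (fun p hp => h p.1 p.2 hp) hc huv

variable [CompleteSpace E]

theorem mem_graph_adjoint_iff {L : E →ₗ.[ℂ] E} (hL : Dense (L.domain : Set E)) {f g : E} :
    (f, g) ∈ L†.graph ↔ ∀ u v, (u, v) ∈ L.graph → inner ℂ v f = inner ℂ u g := by
  rw [LinearPMap.adjoint_graph_eq_graph_adjoint hL, Submodule.mem_adjoint_iff]
  simp only [sub_eq_zero]

/-- In general only the inclusion M†L† ⊆ (LM)† holds. It suffices for computing N_j† on Schwartz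
functions. -/
theorem mem_graph_adjoint_opMul {L M : E →ₗ.[ℂ] E} (hL : Dense (L.domain : Set E))
    (hM : Dense (M.domain : Set E)) (hLM : Dense ((opMul L M).domain : Set E)) {f g h : E}
    (hfg : (f, g) ∈ L†.graph) (hgh : (g, h) ∈ M†.graph) : (f, h) ∈ (opMul L M)†.graph := by
  rw [mem_graph_adjoint_iff hLM]
  intro u w huw
  obtain ⟨v, huv, hvw⟩ := mem_graph_opMul_iff.1 huw
  rw [(mem_graph_adjoint_iff hL).1 hfg v w hvw, (mem_graph_adjoint_iff hM).1 hgh u v huv]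

/-- An operator is self-adjoint if its graph is its own adjoint relation. -/
theorem isSelfAdjoint_of_graph {L : E →ₗ.[ℂ] E} (hL : Dense (L.domain : Set E))
    (h : ∀ f g, (f, g) ∈ L.graph ↔ ∀ u v, (u, v) ∈ L.graph → inner ℂ v f = inner ℂ u g) :
    IsSelfAdjoint L := by
  rw [LinearPMap.isSelfAdjoint_def]
  exact graph_ext fun f g => (mem_graph_adjoint_iff hL).trans (h f g).symm

/-- Symmetry means L ⊆ L†, and adjoints are closed. -/
theorem isClosable_of_symmetric {L : E →ₗ.[ℂ] E} (hL : Dense (L.domain : Set E))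
    (h : ∀ f g, (f, g) ∈ L.graph → ∀ u v, (u, v) ∈ L.graph → inner ℂ v f = inner ℂ u g) :
    L.IsClosable := by
  refine (LinearPMap.adjoint_isClosed hL).isClosable.leIsClosable
    (LinearPMap.le_of_le_graph ?_)
  rintro ⟨f, g⟩ hfg
  exact (mem_graph_adjoint_iff hL).2 (h f g hfg)

end Graphs

/-! ### Transport of operators along unitary maps -/

section Pullback

variable {E F : Type*} [NormedAddCommGroup E] [InnerProductSpace ℂ E]
  [NormedAddCommGroup F] [InnerProductSpace ℂ F]

/-- The operator `U⁻¹ M U`. -/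
def pullback (U : E ≃ₗᵢ[ℂ] F) (M : F →ₗ.[ℂ] F) : E →ₗ.[ℂ] E where
  domain := M.domain.comap U.toLinearEquiv.toLinearMap
  toFun :=
    { toFun := fun x => U.symm (M ⟨U x.1, x.2⟩)
      map_add' := fun x y => by
        rw [← map_add, ← M.map_add]
        congr 2
        exact Subtype.ext (map_add U x.1 y.1)
      map_smul' := fun c x => by
        rw [RingHom.id_apply, ← map_smul, ← M.map_smul]
        congr 2
        exact Subtype.ext (map_smul U c x.1) }

theorem mem_graph_pullback_iff {U : E ≃ₗᵢ[ℂ] F} {M : F →ₗ.[ℂ] F} {f g : E} :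
    (f, g) ∈ (pullback U M).graph ↔ (U f, U g) ∈ M.graph := by
  rw [LinearPMap.mem_graph_iff, LinearPMap.mem_graph_iff]
  constructor
  · rintro ⟨⟨x, hx⟩, hxf, hxk⟩
    simp only at hxf hxk
    subst hxf
    refine ⟨⟨U x, hx⟩, rfl, ?_⟩
    rw [← hxk]
    exact (U.apply_symm_apply _).symm
  · rintro ⟨⟨x, hx⟩, hxf, hxk⟩
    simp only at hxf hxk
    subst hxf
    refine ⟨⟨f, hx⟩, rfl, ?_⟩
    change U.symm (M ⟨U f, hx⟩) = g
    rw [hxk, U.symm_apply_apply]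

theorem dense_domain_pullback {U : E ≃ₗᵢ[ℂ] F} {M : F →ₗ.[ℂ] F} (hM : Dense (M.domain : Set F)) :
    Dense ((pullback U M).domain : Set E) :=
  hM.preimage U.toHomeomorph.isOpenMap

variable [CompleteSpace E] [CompleteSpace F]

theorem isSelfAdjoint_pullback (U : E ≃ₗᵢ[ℂ] F) {M : F →ₗ.[ℂ] F} (hM : IsSelfAdjoint M) :
    IsSelfAdjoint (pullback U M) := by
  refine isSelfAdjoint_of_graph (dense_domain_pullback hM.dense_domain) fun f g => ?_
  rw [mem_graph_pullback_iff]
  nth_rw 1 [← LinearPMap.isSelfAdjoint_def.1 hM]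
  rw [mem_graph_adjoint_iff hM.dense_domain]
  constructor
  · intro h u v huv
    rw [← U.inner_map_map, ← U.inner_map_map u]
    exact h _ _ (mem_graph_pullback_iff.1 huv)
  · intro h u v huv
    have := h (U.symm u) (U.symm v) (mem_graph_pullback_iff.2 (by simpa using huv))
    rwa [← U.inner_map_map, ← U.inner_map_map (U.symm u), U.apply_symm_apply,
      U.apply_symm_apply] at this

end Pullback

/-! ### Multiplication operators and their exponentials -/

section MulOp

variable {α : Type*} [MeasurableSpace α] {μ : Measure α}

theorem mem_domain_mulOp_iff {g : α → ℝ} {f : Lp ℂ 2 μ} :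
    f ∈ (mulOp μ g).domain ↔ MemLp (fun x => (g x : ℂ) * f x) 2 μ := Iff.rfl

theorem mem_graph_mulOp_iff {g : α → ℝ} {f h : Lp ℂ 2 μ} :
    (f, h) ∈ (mulOp μ g).graph ↔ h =ᵐ[μ] fun x => (g x : ℂ) * f x := by
  rw [LinearPMap.mem_graph_iff]
  constructor
  · rintro ⟨⟨x, hx⟩, hxf, hxk⟩
    simp only at hxf hxk
    subst hxf hxk
    exact MemLp.coeFn_toLp (mem_domain_mulOp_iff.1 hx)
  · intro hh
    have hf : MemLp (fun x => (g x : ℂ) * f x) 2 μ := (memLp_congr_ae hh).1 (Lp.memLp h)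
    refine ⟨⟨f, hf⟩, rfl, Lp.ext ?_⟩
    exact (MemLp.coeFn_toLp hf).trans hh.symm

/-- Multiplication operators are symmetric. -/
theorem inner_mulOp_comm {g : α → ℝ} {f h u v : Lp ℂ 2 μ} (hfh : (f, h) ∈ (mulOp μ g).graph)
    (huv : (u, v) ∈ (mulOp μ g).graph) : inner ℂ v f = inner ℂ u h := by
  rw [mem_graph_mulOp_iff] at hfh huv
  rw [L2.inner_def, L2.inner_def]
  refine integral_congr_ae ?_
  filter_upwards [hfh, huv] with x h1 h2
  rw [h1, h2]
  simp only [RCLike.inner_apply, map_mul, Complex.conj_ofReal]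
  ring

theorem memLp_bounded_mul {g : α → ℝ} (hg : Measurable g) {s : Set α}
    (hs : MeasurableSet s) {C : ℝ} (hC : ∀ x ∈ s, |g x| ≤ C) (f : Lp ℂ 2 μ) :
    MemLp (s.indicator fun x => (g x : ℂ) * f x) 2 μ := by
  have hm : AEStronglyMeasurable (s.indicator fun x => (g x : ℂ) * f x) μ :=
    ((Complex.measurable_ofReal.comp hg).aestronglyMeasurable.mul
      (Lp.aestronglyMeasurable f)).indicator hs
  refine MemLp.of_le_mul (Lp.memLp f) hm (c := |C|) (Filter.Eventually.of_forall fun x => ?_)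
  by_cases hx : x ∈ s
  · rw [Set.indicator_of_mem hx, norm_mul, Complex.norm_real, Real.norm_eq_abs]
    exact mul_le_mul_of_nonneg_right ((hC x hx).trans (le_abs_self C)) (norm_nonneg _)
  · rw [Set.indicator_of_notMem hx, norm_zero]
    positivity

/-- Membership in the graph of a multiplication operator can be tested on the vectors that live on
the sets `{|k| ≤ n}`, if the multiplier is bounded on these sets. -/
theorem mem_graph_mulOp_of_truncated {g k : α → ℝ} (hg : Measurable g) (hk : Measurable k)
    (hb : ∀ n : ℕ, ∃ C, ∀ x, |k x| ≤ n → |g x| ≤ C) {f h : Lp ℂ 2 μ}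
    (H : ∀ u v : Lp ℂ 2 μ, (u, v) ∈ (mulOp μ g).graph →
      (∃ n : ℕ, ∀ᵐ x ∂μ, u x ≠ 0 → |k x| ≤ n) → inner ℂ v f = inner ℂ u h) :
    (f, h) ∈ (mulOp μ g).graph := by
  have key : ∀ n : ℕ, ∀ᵐ x ∂μ, |k x| ≤ n → h x = (g x : ℂ) * f x := by
    intro n
    obtain ⟨C, hC⟩ := hb n
    set s : Set α := {x | |k x| ≤ n} with hs_def
    have hs : MeasurableSet s := measurableSet_le hk.abs measurable_const
    -- The test vector is w = 1_s (h - g f). Testing with it gives ‖w‖² = ⟨w, h⟩ - ⟨g w, f⟩ = 0, so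
    -- h = g f a.e. on s; the sets s exhaust the space as n grows.
    have hw₁ : MemLp (s.indicator h) 2 μ := (Lp.memLp h).indicator hs
    have hw₂ := memLp_bounded_mul (μ := μ) hg hs (C := C) (fun x hx => hC x hx) f
    have hw := hw₁.sub hw₂
    set w : Lp ℂ 2 μ := hw.toLp _ with hw_def
    have hwx : ∀ᵐ x ∂μ, w x = s.indicator (fun x => h x - (g x : ℂ) * f x) x := by
      filter_upwards [hw.coeFn_toLp] with x hx
      rw [hw_def, hx, Pi.sub_apply]
      by_cases hxs : x ∈ s <;> simp [hxs]
    have hv := memLp_bounded_mul (μ := μ) hg hs (C := C) (fun x hx => hC x hx) w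
    set v : Lp ℂ 2 μ := hv.toLp _
    have hwv : (w, v) ∈ (mulOp μ g).graph := by
      rw [mem_graph_mulOp_iff]
      filter_upwards [hv.coeFn_toLp, hwx] with x hx hx'
      rw [hx]
      by_cases hxs : x ∈ s
      · rw [Set.indicator_of_mem hxs]
      · rw [Set.indicator_of_notMem hxs, hx', Set.indicator_of_notMem hxs, mul_zero]
    have hwn : ∃ n : ℕ, ∀ᵐ x ∂μ, w x ≠ 0 → |k x| ≤ n := by
      refine ⟨n, ?_⟩
      filter_upwards [hwx] with x hx hne
      by_contra hxs
      replace hxs : x ∉ s := hxs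
      exact hne (by rw [hx, Set.indicator_of_notMem hxs])
    have hinner := H w v hwv hwn
    have hself : inner ℂ w w = inner ℂ w h - inner ℂ v f := by
      rw [L2.inner_def, L2.inner_def, L2.inner_def,
        ← integral_sub (L2.integrable_inner w h) (L2.integrable_inner v f)]
      refine integral_congr_ae ?_
      filter_upwards [hwx, mem_graph_mulOp_iff.1 hwv] with x h1 h2
      rw [h2]
      simp only [RCLike.inner_apply, map_mul, Complex.conj_ofReal]
      by_cases hxs : x ∈ s
      · rw [h1, Set.indicator_of_mem hxs]
        ring
      · rw [h1, Set.indicator_of_notMem hxs]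
        simp
    rw [hinner, sub_self, inner_self_eq_zero] at hself
    filter_upwards [hwx, (Lp.eq_zero_iff_ae_eq_zero.1 hself)] with x h1 h2 hx
    rw [h2, Set.indicator_of_mem (show x ∈ s from hx)] at h1
    exact sub_eq_zero.1 h1.symm
  rw [mem_graph_mulOp_iff]
  filter_upwards [ae_all_iff.2 key] with x hx
  obtain ⟨n, hn⟩ := exists_nat_ge |k x|
  exact hx n hn

/-- For k orthogonal to the domain, the pair (0, k) passes the truncated test, so k = g · 0 = 0. -/
theorem dense_domain_mulOp {g : α → ℝ} (hg : Measurable g) :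
    Dense ((mulOp μ g).domain : Set (Lp ℂ 2 μ)) := by
  rw [Submodule.dense_iff_topologicalClosure_eq_top, Submodule.topologicalClosure_eq_top_iff,
    Submodule.eq_bot_iff]
  intro k hk
  have h0 : ((0 : Lp ℂ 2 μ), k) ∈ (mulOp μ g).graph := by
    refine mem_graph_mulOp_of_truncated hg hg (fun n => ⟨n, fun _ h => h⟩) fun u v huv _ => ?_
    rw [inner_zero_right, (Submodule.mem_orthogonal _ _).1 hk u
      (LinearPMap.mem_domain_of_mem_graph huv)]
  exact LinearPMap.graph_fst_eq_zero_snd _ h0 rfl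

theorem isSelfAdjoint_mulOp {g : α → ℝ} (hg : Measurable g) : IsSelfAdjoint (mulOp μ g) :=
  isSelfAdjoint_of_graph (dense_domain_mulOp hg) fun _ _ =>
    ⟨fun hfh _ _ huv => inner_mulOp_comm hfh huv, fun H =>
      mem_graph_mulOp_of_truncated hg hg (fun n => ⟨n, fun _ h => h⟩) fun u v huv _ => H u v huv⟩

/-- The exponential series of a multiplication operator, on a vector for which it converges. -/
theorem mem_graph_mulOp_exp_tsum {g : α → ℝ} {z : ℕ → Lp ℂ 2 μ} {c M : ℝ}
    (hz : ∀ m, (z m, z (m + 1)) ∈ (mulOp μ g).graph) (hzM : ∀ m, ‖z m‖ ≤ c * M ^ m) :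
    (z 0, ∑' m : ℕ, ((m.factorial : ℂ)⁻¹) • z m) ∈ (mulOp μ fun x => Real.exp (g x)).graph := by
  have hsum : Summable fun m : ℕ => ((m.factorial : ℂ)⁻¹) • z m := by
    refine Summable.of_norm_bounded (g := fun m => c * (M ^ m / m.factorial))
      ((Real.summable_pow_div_factorial M).mul_left c) fun m => ?_
    rw [norm_smul, norm_inv, Complex.norm_natCast, mul_div_assoc', div_eq_inv_mul]
    gcongr
    exact hzM m
  have hpow : ∀ m, ∀ᵐ x ∂μ, z m x = (g x : ℂ) ^ m * z 0 x := by
    intro m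
    induction m with
    | zero => simp
    | succ m ih =>
      filter_upwards [ih, mem_graph_mulOp_iff.1 (hz m)] with x h1 h2
      rw [h2, h1, pow_succ]
      ring
  have hpart : ∀ n : ℕ, ∀ᵐ x ∂μ, (∑ m ∈ Finset.range n, ((m.factorial : ℂ)⁻¹) • z m : Lp ℂ 2 μ) x =
      (∑ m ∈ Finset.range n, (g x : ℂ) ^ m / m.factorial) * z 0 x := by
    intro n
    induction n with
    | zero =>
      filter_upwards [Lp.coeFn_zero ℂ 2 μ] with x hx
      simpa using hx
    | succ n ih =>
      rw [Finset.sum_range_succ]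
      filter_upwards [ih, hpow n,
        Lp.coeFn_add (∑ m ∈ Finset.range n, ((m.factorial : ℂ)⁻¹) • z m)
          (((n.factorial : ℂ)⁻¹) • z n),
        Lp.coeFn_smul ((n.factorial : ℂ)⁻¹) (z n)] with x h1 h2 h3 h4
      rw [h3, Pi.add_apply, h1, h4, Pi.smul_apply, h2, Finset.sum_range_succ, smul_eq_mul]
      ring
  -- Convergence in L² gives a.e. convergence along a subsequence, while the partial sums converge
  -- pointwise to e^{g} z₀. The two limits agree.
  have hlim := hsum.hasSum.tendsto_sum_nat
  obtain ⟨ns, hns, hns_lim⟩ :=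
    (tendstoInMeasure_of_tendsto_Lp hlim).exists_seq_tendsto_ae
  rw [mem_graph_mulOp_iff]
  filter_upwards [hns_lim, ae_all_iff.2 hpart] with x h1 h2
  refine tendsto_nhds_unique h1 ?_
  simp only [h2]
  refine Filter.Tendsto.mul_const _ ?_
  have := (NormedSpace.expSeries_div_hasSum_exp (g x : ℂ)).tendsto_sum_nat.comp hns.tendsto_atTop
  rw [← Complex.exp_eq_exp_ℂ] at this
  rw [Complex.ofReal_exp]
  exact this

/-- Vectors living where |g| ≤ n are entire vectors: the m-th power of the operator grows at most
like n^m on them, so their exponential series converges. -/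
theorem exists_powers_of_truncated {g : α → ℝ} (hg : Measurable g) {u : Lp ℂ 2 μ} {n : ℕ}
    (hu : ∀ᵐ x ∂μ, u x ≠ 0 → |g x| ≤ n) :
    ∃ z : ℕ → Lp ℂ 2 μ, z 0 = u ∧ (∀ m, (z m, z (m + 1)) ∈ (mulOp μ g).graph) ∧
      ∀ m, ‖z m‖ ≤ ‖u‖ * (n : ℝ) ^ m := by
  have hle : ∀ m, ∀ᵐ x ∂μ, ‖(g x : ℂ) ^ m * u x‖ ≤ (n : ℝ) ^ m * ‖u x‖ := by
    intro m
    filter_upwards [hu] with x hx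
    by_cases h0 : u x = 0
    · simp [h0]
    · rw [norm_mul, norm_pow, Complex.norm_real, Real.norm_eq_abs]
      gcongr
      exact hx h0
  have hmem : ∀ m, MemLp (fun x => (g x : ℂ) ^ m * u x) 2 μ := fun m =>
    MemLp.of_le_mul (Lp.memLp u) (((Complex.measurable_ofReal.comp hg).pow_const
      m).aestronglyMeasurable.mul (Lp.aestronglyMeasurable u)) (hle m)
  refine ⟨fun m => (hmem m).toLp _, Lp.ext ?_, fun m => ?_, fun m => ?_⟩
  · filter_upwards [(hmem 0).coeFn_toLp] with x hx
    rw [hx, pow_zero, one_mul]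
  · rw [mem_graph_mulOp_iff]
    filter_upwards [(hmem m).coeFn_toLp, (hmem (m + 1)).coeFn_toLp] with x h1 h2
    rw [h1, h2, pow_succ]
    ring
  · rw [mul_comm]
    refine Lp.norm_le_mul_norm_of_ae_le_mul ?_
    filter_upwards [(hmem m).coeFn_toLp, hle m] with x h1 h2
    rwa [h1]

end MulOp

/-! ### Independence of the exponential from the spectral representation -/

section Uniqueness

variable {E : Type*} [NormedAddCommGroup E] [InnerProductSpace ℂ E]

/-- On spectrally truncated vectors of the second representation, S' is the exponential series of K.
That series involves only powers of K, so it also computes S there. Symmetry of S then gives ⟨S'u,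
f⟩ = ⟨u, k⟩ for all truncated u, and these u detect the graph of S'. -/
theorem IsFunctionOf.exp_graph_le {K S S' : E →ₗ.[ℂ] E} (h : IsFunctionOf Real.exp K S)
    (h' : IsFunctionOf Real.exp K S') {f k : E} (hfk : (f, k) ∈ S.graph) : (f, k) ∈ S'.graph := by
  obtain ⟨α, _, μ, _, g, U, hg, hK, hS⟩ := h
  obtain ⟨β, _, ν, _, g', U', hg', hK', hS'⟩ := h'
  rw [hS']
  refine mem_graph_mulOp_of_truncated (Real.measurable_exp.comp hg') hg'
    (fun n => ⟨Real.exp n, fun x hx => ?_⟩) fun u v huv ⟨n, hn⟩ => ?_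
  · rw [Function.comp_apply, Real.abs_exp]
    exact Real.exp_le_exp.2 ((le_abs_self _).trans hx)
  obtain ⟨z, rfl, hz, hzn⟩ := exists_powers_of_truncated hg' hn
  set W : Lp ℂ 2 ν ≃ₗᵢ[ℂ] Lp ℂ 2 μ := U'.symm.trans U
  have hW : ∀ m, (W (z m), W (z (m + 1))) ∈ (mulOp μ g).graph := fun m => by
    rw [LinearIsometryEquiv.trans_apply, LinearIsometryEquiv.trans_apply, ← hK, hK']
    simpa using hz m
  have h1 := mem_graph_mulOp_exp_tsum hW (c := ‖z 0‖) (M := n)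
    (fun m => by rw [W.norm_map]; exact hzn m)
  have h2 := LinearPMap.mem_graph_snd_inj _ huv (mem_graph_mulOp_exp_tsum hz hzn) rfl
  have h3 : W v = ∑' m : ℕ, ((m.factorial : ℂ)⁻¹) • W (z m) := by
    rw [h2]
    refine (W.toContinuousLinearEquiv.map_tsum).trans (tsum_congr fun m => ?_)
    exact map_smul W _ _
  rw [← h3] at h1
  have h4 := inner_mulOp_comm ((hS f k).1 hfk) h1
  have h5 : ∀ w e, inner ℂ (W w) (U e) = inner ℂ w (U' e) := fun w e => by
    rw [LinearIsometryEquiv.trans_apply, U.inner_map_map, ← U'.inner_map_map, U'.apply_symm_apply]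
  rwa [h5, h5] at h4

/-- The exponential of a self-adjoint operator is unique. -/
theorem IsFunctionOf.exp_unique {K S S' : E →ₗ.[ℂ] E} (h : IsFunctionOf Real.exp K S)
    (h' : IsFunctionOf Real.exp K S') : S = S' :=
  graph_ext fun _ _ => ⟨h.exp_graph_le h', h'.exp_graph_le h⟩

end Uniqueness

/-! ### Schwartz functions given by exponentials -/

section Exponentials

open scoped ContDiff Nat

variable {V : Type*} [NormedAddCommGroup V] [NormedSpace ℝ V]

/-- All complex derivatives of exp are exp, and restricting scalars to ℝ preserves the norm of a
multilinear map. -/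
theorem norm_iteratedFDeriv_cexp (n : ℕ) (z : ℂ) :
    ‖iteratedFDeriv ℝ n Complex.exp z‖ = Real.exp z.re := by
  have h : ContDiffAt ℂ n Complex.exp z := Complex.contDiff_exp.contDiffAt
  rw [← h.restrictScalars_iteratedFDeriv (𝕜 := ℝ), Function.comp_apply,
    ContinuousMultilinearMap.norm_restrictScalars, norm_iteratedFDeriv_eq_norm_iteratedDeriv,
    iteratedDeriv_eq_iterate, Complex.iter_deriv_exp, Complex.norm_exp]

theorem exists_norm_iteratedFDeriv_cexp_comp_le {q : V → ℂ} (hq : q.HasTemperateGrowth) (n : ℕ) :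
    ∃ (k : ℕ) (C : ℝ), 0 ≤ C ∧ ∀ x, ‖iteratedFDeriv ℝ n (fun x => Complex.exp (q x)) x‖ ≤
      C * (1 + ‖x‖) ^ k * Real.exp (q x).re := by
  obtain ⟨k, C, hC, h⟩ := hq.norm_iteratedFDeriv_le_uniform n
  refine ⟨k * n, n ! * (1 + C) ^ n, by positivity, fun x => ?_⟩
  -- The chain rule estimate wants a D with i-th derivative of q bounded by D^i for 1 ≤ i ≤ n. As
  -- this D is at least 1, one bound by D serves all i; enlarging C to 1 + C ensures D ≥ 1.
  have h1 : (1 : ℝ) ≤ (1 + C) * (1 + ‖x‖) ^ k :=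
    one_le_mul_of_one_le_of_one_le (by linarith) (one_le_pow₀ (by simp))
  have := norm_iteratedFDeriv_comp_le (𝕜 := ℝ) (g := Complex.exp) (N := ∞) (n := n)
    Complex.contDiff_exp hq.1 (mod_cast le_top) x (C := Real.exp (q x).re)
    (D := (1 + C) * (1 + ‖x‖) ^ k) (fun i _ => (norm_iteratedFDeriv_cexp i _).le)
    (fun i hi hin => (h i hin x).trans (le_trans
      (mul_le_mul_of_nonneg_right (by linarith) (by positivity)) (le_self_pow₀ h1 (by omega))))
  refine this.trans_eq ?_
  rw [mul_pow, ← pow_mul]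
  ring

theorem hasTemperateGrowth_cexp {q : V → ℂ} (hq : q.HasTemperateGrowth) (hre : ∀ x, (q x).re ≤ 0) :
    (fun x => Complex.exp (q x)).HasTemperateGrowth := by
  refine ⟨Complex.contDiff_exp.comp hq.1, fun n => ?_⟩
  obtain ⟨k, C, hC, h⟩ := exists_norm_iteratedFDeriv_cexp_comp_le hq n
  refine ⟨k, C, fun x => (h x).trans ?_⟩
  exact mul_le_of_le_one_right (by positivity) (Real.exp_le_one_iff.2 (hre x))

/-- The power is absorbed into m! e^{1+r}, and completing the square bounds r - δr² by 1/(4δ). -/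
theorem one_add_pow_mul_exp_neg_sq_le (m : ℕ) {δ r : ℝ} (hδ : 0 < δ) (hr : 0 ≤ r) :
    (1 + r) ^ m * Real.exp (-δ * r ^ 2) ≤ m ! * Real.exp (1 + 1 / (4 * δ)) := by
  have h1 : (1 + r) ^ m ≤ m ! * Real.exp (1 + r) := by
    have := Real.pow_div_factorial_le_exp (1 + r) (by linarith) m
    rwa [div_le_iff₀' (by positivity)] at this
  have h2 : r - δ * r ^ 2 ≤ 1 / (4 * δ) := by
    rw [le_div_iff₀ (by positivity)]
    nlinarith [sq_nonneg (2 * δ * r - 1)]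
  calc (1 + r) ^ m * Real.exp (-δ * r ^ 2) ≤ m ! * Real.exp (1 + r) * Real.exp (-δ * r ^ 2) := by
        gcongr
    _ = m ! * Real.exp (1 + (r - δ * r ^ 2)) := by
        rw [mul_assoc, ← Real.exp_add]
        ring_nf
    _ ≤ _ := by gcongr

/-- `exp ∘ q` as a Schwartz function, if `q` is of temperate growth and `Re q` tends to `-∞`
quadratically. -/
def expSchwartz (q : V → ℂ) (hq : q.HasTemperateGrowth)
    (hre : ∃ M δ : ℝ, 0 < δ ∧ ∀ x, (q x).re ≤ M - δ * ‖x‖ ^ 2) : 𝓢(V, ℂ) where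
  toFun x := Complex.exp (q x)
  smooth' := Complex.contDiff_exp.comp hq.1
  decay' l n := by
    obtain ⟨k, C, hC, h⟩ := exists_norm_iteratedFDeriv_cexp_comp_le hq n
    obtain ⟨M, δ, hδ, hM⟩ := hre
    refine ⟨C * Real.exp M * ((l + k) ! * Real.exp (1 + 1 / (4 * δ))), fun x => ?_⟩
    calc ‖x‖ ^ l * ‖iteratedFDeriv ℝ n (fun x => Complex.exp (q x)) x‖
        ≤ (1 + ‖x‖) ^ l * (C * (1 + ‖x‖) ^ k * Real.exp (M - δ * ‖x‖ ^ 2)) := by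
          gcongr
          · linarith
          · exact (h x).trans (by gcongr; exact hM x)
      _ = C * Real.exp M * ((1 + ‖x‖) ^ (l + k) * Real.exp (-δ * ‖x‖ ^ 2)) := by
          rw [sub_eq_add_neg, Real.exp_add, pow_add]
          ring_nf
      _ ≤ _ := by
          exact mul_le_mul_of_nonneg_left (one_add_pow_mul_exp_neg_sq_le _ hδ (norm_nonneg x))
            (by positivity)

end Exponentials

/-! ### Quadratic exponents on the plane -/

/-- The coordinate `y_j`, as a complex valued linear form. -/
def coordL (j : Fin 2) : Plane →L[ℝ] ℂ := Complex.ofRealCLM ∘L EuclideanSpace.proj j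

@[simp]
theorem coordL_apply (j : Fin 2) (y : Plane) : coordL j y = (y j : ℂ) := rfl

@[fun_prop]
theorem hasTemperateGrowth_coord (j : Fin 2) :
    (fun y : Plane => (y j : ℂ)).HasTemperateGrowth := (coordL j).hasTemperateGrowth

/-- The function `-(z/2)(y₁²+y₂²) + w₁y₁ + w₂y₂`. -/
def quad (z : ℂ) (w : Fin 2 → ℂ) (y : Plane) : ℂ :=
  -(z / 2) * ((y 0 : ℂ) ^ 2 + (y 1 : ℂ) ^ 2) + (w 0 * y 0 + w 1 * y 1)

theorem hasTemperateGrowth_quad (z : ℂ) (w : Fin 2 → ℂ) : (quad z w).HasTemperateGrowth := by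
  unfold quad
  fun_prop

theorem plane_norm_sq (y : Plane) : ‖y‖ ^ 2 = y 0 ^ 2 + y 1 ^ 2 := by
  rw [EuclideanSpace.real_norm_sq_eq, Fin.sum_univ_two]

theorem quad_re (z : ℂ) (w : Fin 2 → ℂ) (y : Plane) :
    (quad z w y).re = -(z.re / 2) * ‖y‖ ^ 2 + ((w 0).re * y 0 + (w 1).re * y 1) := by
  have : quad z w y = -(z / 2) * ((‖y‖ ^ 2 : ℝ) : ℂ) + (w 0 * (y 0 : ℝ) + w 1 * (y 1 : ℝ)) := by
    rw [plane_norm_sq, quad]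
    push_cast
    ring
  rw [this, Complex.add_re, Complex.add_re, Complex.re_mul_ofReal, Complex.re_mul_ofReal,
    Complex.re_mul_ofReal, Complex.neg_re, Complex.div_ofNat_re]

theorem exists_quad_re_le {z : ℂ} (hz : 0 < z.re) (w : Fin 2 → ℂ) :
    ∃ M δ : ℝ, 0 < δ ∧ ∀ y, (quad z w y).re ≤ M - δ * ‖y‖ ^ 2 := by
  -- Half of the quadratic decay Re z / 2 pays for the linear terms by Young's inequality; the other
  -- half is δ = Re z / 4.
  refine ⟨(w 0).re ^ 2 / z.re + (w 1).re ^ 2 / z.re, z.re / 4, by positivity, fun y => ?_⟩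
  have key : ∀ a t : ℝ, a * t ≤ a ^ 2 / z.re + z.re / 4 * t ^ 2 := by
    intro a t
    rw [← sub_nonneg]
    have : a ^ 2 / z.re + z.re / 4 * t ^ 2 - a * t = (a - z.re / 2 * t) ^ 2 / z.re := by
      field_simp
      ring
    rw [this]
    positivity
  rw [quad_re, plane_norm_sq]
  nlinarith [key (w 0).re (y 0), key (w 1).re (y 1)]

/-- The Schwartz function `exp(-(z/2)(y₁²+y₂²) + w₁y₁ + w₂y₂)`, for `Re z > 0`. -/
def gaussS (z : ℂ) (hz : 0 < z.re) (w : Fin 2 → ℂ) : 𝓢(Plane, ℂ) :=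
  expSchwartz (quad z w) (hasTemperateGrowth_quad z w) (exists_quad_re_le hz w)

@[simp]
theorem gaussS_apply {z : ℂ} {hz : 0 < z.re} {w : Fin 2 → ℂ} (y : Plane) :
    gaussS z hz w y = Complex.exp (quad z w y) := rfl

theorem hasFDerivAt_quad (z : ℂ) (w : Fin 2 → ℂ) (y : Plane) :
    HasFDerivAt (quad z w) ((-z * y 0 + w 0) • coordL 0 + (-z * y 1 + w 1) • coordL 1) y := by
  have h0 := (coordL 0).hasFDerivAt (x := y)
  have h1 := (coordL 1).hasFDerivAt (x := y)
  have := (((h0.pow 2).add (h1.pow 2)).const_mul (-(z / 2))).add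
    ((h0.const_mul (w 0)).add (h1.const_mul (w 1)))
  convert! this using 1
  ext v
  simp
  ring

theorem quad_lineDeriv (z : ℂ) (w : Fin 2 → ℂ) (y : Plane) (j : Fin 2) :
    ((-z * y 0 + w 0) • coordL 0 + (-z * y 1 + w 1) • coordL 1)
      (EuclideanSpace.single j (1 : ℝ)) = -z * y j + w j := by
  fin_cases j <;> simp

/-! ### Position and momentum on Schwartz functions -/

/-- Multiplication by the coordinate `y_j` on `𝒮(ℝ²)`. -/
def xS (j : Fin 2) : 𝓢(Plane, ℂ) →ₗ[ℂ] 𝓢(Plane, ℂ) :=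
  (SchwartzMap.smulLeftCLM ℂ fun y : Plane => (y j : ℂ)).toLinearMap

/-- The partial derivative `∂_j` on `𝒮(ℝ²)`. -/
def dS (j : Fin 2) : 𝓢(Plane, ℂ) →ₗ[ℂ] 𝓢(Plane, ℂ) :=
  (LineDeriv.lineDerivOpCLM ℂ 𝓢(Plane, ℂ) (EuclideanSpace.single j (1 : ℝ))).toLinearMap

/-- The momentum `-i ∂_j` on `𝒮(ℝ²)`. -/
def pS (j : Fin 2) : 𝓢(Plane, ℂ) →ₗ[ℂ] 𝓢(Plane, ℂ) := -Complex.I • dS j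

@[simp]
theorem xS_apply (j : Fin 2) (f : 𝓢(Plane, ℂ)) (y : Plane) : xS j f y = y j * f y :=
  SchwartzMap.smulLeftCLM_apply_apply (hasTemperateGrowth_coord j) f y

theorem dS_apply (j : Fin 2) (f : 𝓢(Plane, ℂ)) (y : Plane) :
    dS j f y = fderiv ℝ f y (EuclideanSpace.single j (1 : ℝ)) := by
  change (∂_{EuclideanSpace.single j (1 : ℝ)} f) y = _
  rw [SchwartzMap.lineDerivOp_apply]
  exact f.differentiableAt.lineDeriv_eq_fderiv

theorem pS_apply (j : Fin 2) (f : 𝓢(Plane, ℂ)) : pS j f = -Complex.I • dS j f := rfl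

theorem dS_eq_of_hasFDerivAt {f : 𝓢(Plane, ℂ)} {y : Plane} {f' : Plane →L[ℝ] ℂ}
    (h : HasFDerivAt f f' y) (j : Fin 2) : dS j f y = f' (EuclideanSpace.single j (1 : ℝ)) := by
  rw [dS_apply, h.fderiv]

theorem xS_comm (j k : Fin 2) (f : 𝓢(Plane, ℂ)) : xS j (xS k f) = xS k (xS j f) := by
  ext y
  simp only [xS_apply]
  ring

theorem dS_xS (j k : Fin 2) (f : 𝓢(Plane, ℂ)) :
    dS j (xS k f) = xS k (dS j f) + if j = k then f else 0 := by
  ext y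
  have h : HasFDerivAt (xS k f) _ y :=
    (((coordL k).hasFDerivAt (x := y)).mul f.differentiableAt.hasFDerivAt).congr_of_eventuallyEq
      (Filter.Eventually.of_forall fun y => xS_apply k f y)
  rw [dS_eq_of_hasFDerivAt h]
  rcases eq_or_ne j k with rfl | hjk
  · simp [dS_apply]
  · simp [hjk, dS_apply]

theorem dS_comm (j k : Fin 2) (f : 𝓢(Plane, ℂ)) : dS j (dS k f) = dS k (dS j f) := by
  ext y
  have hf : ContDiff ℝ 2 f := f.smooth 2
  have key : ∀ j k, dS j (dS k f) y = fderiv ℝ (fderiv ℝ f) y (EuclideanSpace.single j (1 : ℝ))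
      (EuclideanSpace.single k (1 : ℝ)) := by
    intro j k
    have hd : DifferentiableAt ℝ (fderiv ℝ f) y :=
      (hf.fderiv_right (m := 1) (by norm_num)).differentiable (by norm_num) y
    have h : HasFDerivAt (dS k f) _ y :=
      ((ContinuousLinearMap.apply ℝ ℂ (EuclideanSpace.single k (1 : ℝ))).hasFDerivAt.comp y
        hd.hasFDerivAt).congr_of_eventuallyEq (Filter.Eventually.of_forall fun y => dS_apply k f y)
    rw [dS_eq_of_hasFDerivAt h]
    rfl
  rw [key, key]
  exact (hf.contDiffAt.isSymmSndFDerivAt (by simp)) _ _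

theorem pS_xS (j k : Fin 2) (f : 𝓢(Plane, ℂ)) :
    pS j (xS k f) = xS k (pS j f) - if j = k then Complex.I • f else 0 := by
  rw [pS_apply, dS_xS, pS_apply, map_smul, smul_add]
  split_ifs
  · rw [neg_smul, neg_smul]
    abel
  · simp

theorem pS_comm (j k : Fin 2) (f : 𝓢(Plane, ℂ)) : pS j (pS k f) = pS k (pS j f) := by
  simp only [pS_apply, map_smul, dS_comm j k f]

/-- A Schwartz function with `∂_j h = (-z y_j + w_j) h` is a multiple of
`exp(-(z/2)(y₁²+y₂²) + w₁y₁ + w₂y₂)`. -/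
theorem exists_eq_const_mul_exp_quad {h : 𝓢(Plane, ℂ)} {z : ℂ} {w : Fin 2 → ℂ}
    (hh : ∀ j y, dS j h y = (-z * y j + w j) * h y) :
    ∃ N : ℂ, ∀ y, h y = N * Complex.exp (quad z w y) := by
  -- By the product rule the quotient of h by the exponential has vanishing derivative. Testing on
  -- the coordinate basis suffices.
  have hder : ∀ y, HasFDerivAt (fun y => h y * Complex.exp (-quad z w y))
      (0 : Plane →L[ℝ] ℂ) y := by
    intro y
    have h1 := (h.differentiableAt (x := y)).hasFDerivAt.mul (hasFDerivAt_quad z w y).neg.cexp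
    convert! h1 using 1
    refine ContinuousLinearMap.coe_injective
      ((EuclideanSpace.basisFun (Fin 2) ℝ).toBasis.ext fun j => ?_)
    have h2 := hh j y
    rw [dS_apply] at h2
    have h3 := quad_lineDeriv z w y j
    simp only [OrthonormalBasis.coe_toBasis, EuclideanSpace.basisFun_apply,
      ContinuousLinearMap.coe_coe, zero_apply, add_apply,
      smul_apply, neg_apply] at h2 h3 ⊢
    rw [h2, h3]
    simp only [smul_eq_mul]
    ring
  refine ⟨h 0 * Complex.exp (-quad z w 0), fun y => ?_⟩
  have hc := is_const_of_fderiv_eq_zero (𝕜 := ℝ) (fun y => (hder y).differentiableAt)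
    (fun y => (hder y).fderiv) 0 y
  rw [hc, mul_assoc, ← Complex.exp_add, neg_add_cancel, Complex.exp_zero, mul_one]

theorem dS_gaussS {z : ℂ} {hz : 0 < z.re} {w : Fin 2 → ℂ} (j : Fin 2) (y : Plane) :
    dS j (gaussS z hz w) y = (-z * y j + w j) * gaussS z hz w y := by
  have h : HasFDerivAt (gaussS z hz w) _ y := (hasFDerivAt_quad z w y).cexp
  rw [dS_eq_of_hasFDerivAt h, smul_apply, quad_lineDeriv, smul_eq_mul, mul_comm,
    gaussS_apply]

/-! ### The embedding of Schwartz functions in `L²` -/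

theorem coeFn_embed (f : 𝓢(Plane, ℂ)) : (embed f : Plane → ℂ) =ᵐ[volume] f :=
  SchwartzMap.coeFn_toLp f 2 volume

theorem dense_schwartz : Dense (schwartz : Set Hil) := by
  have := SchwartzMap.denseRange_toLpCLM (E := Plane) (F := ℂ) (p := 2) (by simp)
    (μ := (volume : Measure Plane))
  exact this

theorem embed_mem (f : 𝓢(Plane, ℂ)) : embed f ∈ schwartz := ⟨f, rfl⟩

theorem inner_embed (f g : 𝓢(Plane, ℂ)) :
    inner ℂ (embed f) (embed g) = ∫ y, starRingEnd ℂ (f y) * g y := by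
  refine (SchwartzMap.inner_toL2_toL2_eq f g).trans (integral_congr_ae ?_)
  exact Filter.Eventually.of_forall fun y => by simp [mul_comm]

theorem inner_pS (j : Fin 2) (f g : 𝓢(Plane, ℂ)) :
    inner ℂ (embed (pS j f)) (embed g) = inner ℂ (embed f) (embed (pS j g)) := by
  have h := SchwartzMap.integral_bilinear_lineDerivOp_right_eq_neg_left (μ := volume) f g
    ((ContinuousLinearMap.mul ℝ ℂ).comp Complex.conjCLE.toContinuousLinearMap)
    (EuclideanSpace.single j (1 : ℝ))
  rw [pS_apply, pS_apply, map_smul, map_smul, inner_smul_left, inner_smul_right, inner_embed,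
    inner_embed]
  have h1 : ∫ y, starRingEnd ℂ (f y) * dS j g y = -∫ y, starRingEnd ℂ (dS j f y) * g y := h
  rw [h1]
  simp

theorem mem_graph_mulOp_embed_iff {g : Plane → ℝ} (hg : Continuous g) {f h : 𝓢(Plane, ℂ)} :
    (embed f, embed h) ∈ (mulOp volume g).graph ↔ ∀ y, h y = g y * f y := by
  rw [mem_graph_mulOp_iff]
  constructor
  · intro H
    have : (h : Plane → ℂ) =ᵐ[volume] fun y => (g y : ℂ) * f y := by
      filter_upwards [H, coeFn_embed f, coeFn_embed h] with y h1 h2 h3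
      rw [← h3, h1, h2]
    exact congrFun ((Continuous.ae_eq_iff_eq volume h.continuous (by fun_prop)).1 this)
  · intro H
    filter_upwards [coeFn_embed f, coeFn_embed h] with y h2 h3
    rw [h3, h2, H]

theorem mem_graph_xOp (j : Fin 2) (f : 𝓢(Plane, ℂ)) :
    (embed f, embed (xS j f)) ∈ (xOp j).graph :=
  (mem_graph_mulOp_embed_iff (by fun_prop)).2 (xS_apply j f)

theorem mem_graph_ofSchwartz_iff {L : 𝓢(Plane, ℂ) →ₗ[ℂ] 𝓢(Plane, ℂ)} {u v : Hil} :
    (u, v) ∈ (ofSchwartz L).graph ↔ ∃ f, u = embed f ∧ v = embed (L f) := by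
  rw [LinearPMap.mem_graph_iff]
  have key : ∀ f : 𝓢(Plane, ℂ), ofSchwartz L ⟨embed f, embed_mem f⟩ = embed (L f) := by
    intro f
    change embed (L ((LinearEquiv.ofInjective embed embed_injective).symm _)) = _
    congr 2
    exact (LinearEquiv.ofInjective embed embed_injective).symm_apply_apply f
  constructor
  · rintro ⟨⟨x, f, rfl⟩, hxf, hxk⟩
    exact ⟨f, hxf.symm, hxk.symm.trans (key f)⟩
  · rintro ⟨f, rfl, rfl⟩
    exact ⟨⟨embed f, embed_mem f⟩, rfl, key f⟩

theorem isClosable_ofSchwartz_pS (j : Fin 2) : (ofSchwartz (pS j)).IsClosable := by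
  refine isClosable_of_symmetric dense_schwartz ?_
  intro f g hfg u v huv
  obtain ⟨f, rfl, rfl⟩ := mem_graph_ofSchwartz_iff.1 hfg
  obtain ⟨u, rfl, rfl⟩ := mem_graph_ofSchwartz_iff.1 huv
  exact inner_pS j u f

theorem mem_graph_pOp (j : Fin 2) (f : 𝓢(Plane, ℂ)) :
    (embed f, embed (pS j f)) ∈ (pOp j).graph :=
  LinearPMap.le_graph_of_le (LinearPMap.le_closure _) (mem_graph_ofSchwartz_iff.2 ⟨f, rfl, rfl⟩)

theorem inner_xOp {j : Fin 2} {u v : Hil} (huv : (u, v) ∈ (xOp j).graph) (f : 𝓢(Plane, ℂ)) :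
    inner ℂ v (embed f) = inner ℂ u (embed (xS j f)) :=
  inner_mulOp_comm (mem_graph_xOp j f) huv

/-- Integration by parts survives the closure in one argument. One Schwartz argument is enough for
the action of all adjoints on 𝒮. -/
theorem inner_pOp {j : Fin 2} {u v : Hil} (huv : (u, v) ∈ (pOp j).graph) (f : 𝓢(Plane, ℂ)) :
    inner ℂ v (embed f) = inner ℂ u (embed (pS j f)) := by
  refine inner_eq_of_mem_graph_closure (isClosable_ofSchwartz_pS j) ?_ huv
  intro u v huv
  obtain ⟨u, rfl, rfl⟩ := mem_graph_ofSchwartz_iff.1 huv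
  exact inner_pS j u f

/-! ### Ladder operators on Schwartz functions -/

/-- The operator `(x_j + i p_j + s C)/√2` on `𝒮(ℝ²)`. -/
def lo (A B s : ℝ) (j : Fin 2) : 𝓢(Plane, ℂ) →ₗ[ℂ] 𝓢(Plane, ℂ) :=
  (1 / (√2 : ℝ) : ℂ) • (xS j + Complex.I • pS j + (s * constC A B) • LinearMap.id)

/-- The operator `(x_j - i p_j + s D)/√2` on `𝒮(ℝ²)`. -/
def hi (A B s : ℝ) (j : Fin 2) : 𝓢(Plane, ℂ) →ₗ[ℂ] 𝓢(Plane, ℂ) :=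
  (1 / (√2 : ℝ) : ℂ) • (xS j - Complex.I • pS j + (s * constD A B) • LinearMap.id)

theorem lo_apply (A B s : ℝ) (j : Fin 2) (f : 𝓢(Plane, ℂ)) :
    lo A B s j f = (1 / (√2 : ℝ) : ℂ) • (xS j f + Complex.I • pS j f + (s * constC A B) • f) := rfl

theorem hi_apply (A B s : ℝ) (j : Fin 2) (f : 𝓢(Plane, ℂ)) :
    hi A B s j f = (1 / (√2 : ℝ) : ℂ) • (xS j f - Complex.I • pS j f + (s * constD A B) • f) := rfl

theorem one_div_sqrt_two_mul_self :
    (1 / (√2 : ℝ) : ℂ) * (1 / (√2 : ℝ) : ℂ) = 1 / 2 := by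
  rw [div_mul_div_comm, one_mul, ← Complex.ofReal_mul, Real.mul_self_sqrt (by norm_num)]
  norm_num

theorem one_div_sqrt_two_ne_zero : (1 / (√2 : ℝ) : ℂ) ≠ 0 := by
  intro h
  have := one_div_sqrt_two_mul_self
  rw [h] at this
  norm_num at this

theorem conj_one_div_sqrt_two : starRingEnd ℂ (1 / (√2 : ℝ) : ℂ) = (1 / (√2 : ℝ) : ℂ) := by
  rw [map_div₀, map_one, Complex.conj_ofReal]

theorem conj_constC (A B : ℝ) : starRingEnd ℂ (constC A B) = -constD A B := by
  simp [constC, constD]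
  ring

theorem conj_constD (A B : ℝ) : starRingEnd ℂ (constD A B) = -constC A B := by
  simp [constC, constD]
  ring

/-- The scalar shifts drop out of the commutator, so the canonical relation holds for every s at
once. -/
theorem lo_hi (A B s : ℝ) (j k : Fin 2) (f : 𝓢(Plane, ℂ)) :
    lo A B s j (hi A B s k f) - hi A B s k (lo A B s j f) = if j = k then f else 0 := by
  have hr := one_div_sqrt_two_mul_self
  have hI := Complex.I_mul_I
  simp only [lo_apply, hi_apply, map_smul, map_add, map_sub, pS_xS, pS_comm k j f, xS_comm k j f]
  generalize (1 / (√2 : ℝ) : ℂ) = r at *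
  generalize Complex.I = i at *
  rcases eq_or_ne j k with rfl | hjk
  · simp only [if_true]
    ext y
    simp only [add_apply, sub_apply, smul_apply, smul_eq_mul]
    linear_combination (-2 * i * i * f y) * hr - f y * hI
  · simp only [hjk, hjk.symm, if_false]
    ext y
    simp only [add_apply, sub_apply, smul_apply, smul_eq_mul, zero_apply]
    ring

theorem lo_comm (A B s : ℝ) (j k : Fin 2) (f : 𝓢(Plane, ℂ)) :
    lo A B s j (lo A B s k f) = lo A B s k (lo A B s j f) := by
  simp only [lo_apply, map_smul, map_add, pS_xS, pS_comm k j f, xS_comm k j f]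
  rcases eq_or_ne j k with rfl | hjk
  · rfl
  · simp only [hjk, hjk.symm, if_false]
    module

theorem hi_comm (A B s : ℝ) (j k : Fin 2) (f : 𝓢(Plane, ℂ)) :
    hi A B s j (hi A B s k f) = hi A B s k (hi A B s j f) := by
  simp only [hi_apply, map_smul, map_add, map_sub, pS_xS, pS_comm k j f, xS_comm k j f]
  rcases eq_or_ne j k with rfl | hjk
  · rfl
  · simp only [hjk, hjk.symm, if_false]
    module

/-! ### The unbounded operators of the model on Schwartz functions -/

theorem mem_graph_aOp (A B : ℝ) (j : Fin 2) (f : 𝓢(Plane, ℂ)) :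
    (embed f, embed (lo A B 1 j f)) ∈ (aOp A B j).graph := by
  have := mem_graph_smul (1 / (√2 : ℝ) : ℂ) (mem_graph_add (mem_graph_add (mem_graph_xOp j f)
    (mem_graph_smul Complex.I (mem_graph_pOp j f)))
    (mem_graph_scalarOp_iff (c := constC A B).2 rfl))
  rw [lo_apply, Complex.ofReal_one, one_mul, map_smul, map_add, map_add, map_smul, map_smul]
  exact this

theorem mem_graph_bOp (A B : ℝ) (j : Fin 2) (f : 𝓢(Plane, ℂ)) :
    (embed f, embed (hi A B 1 j f)) ∈ (bOp A B j).graph := by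
  have := mem_graph_smul (1 / (√2 : ℝ) : ℂ) (mem_graph_add (mem_graph_sub (mem_graph_xOp j f)
    (mem_graph_smul Complex.I (mem_graph_pOp j f)))
    (mem_graph_scalarOp_iff (c := constD A B).2 rfl))
  rw [hi_apply, Complex.ofReal_one, one_mul, map_smul, map_add, map_sub, map_smul, map_smul]
  exact this

theorem mem_graph_cOp (A B : ℝ) (j : Fin 2) (f : 𝓢(Plane, ℂ)) :
    (embed f, embed (lo A B 0 j f)) ∈ (cOp j).graph := by
  have := mem_graph_smul (1 / (√2 : ℝ) : ℂ) (mem_graph_add (mem_graph_xOp j f)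
    (mem_graph_smul Complex.I (mem_graph_pOp j f)))
  rw [lo_apply, Complex.ofReal_zero, zero_mul, zero_smul, add_zero, map_smul, map_add, map_smul]
  exact this

theorem dense_domain_of_schwartz {L : Hil →ₗ.[ℂ] Hil}
    (hL : ∀ f, ∃ g, (embed f, g) ∈ L.graph) : Dense (L.domain : Set Hil) := by
  refine dense_schwartz.mono ?_
  rintro _ ⟨f, rfl⟩
  obtain ⟨g, hg⟩ := hL f
  exact LinearPMap.mem_domain_of_mem_graph hg

theorem dense_domain_aOp (A B : ℝ) (j : Fin 2) : Dense ((aOp A B j).domain : Set Hil) :=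
  dense_domain_of_schwartz fun f => ⟨_, mem_graph_aOp A B j f⟩

theorem dense_domain_bOp (A B : ℝ) (j : Fin 2) : Dense ((bOp A B j).domain : Set Hil) :=
  dense_domain_of_schwartz fun f => ⟨_, mem_graph_bOp A B j f⟩

theorem dense_domain_cOp (j : Fin 2) : Dense ((cOp j).domain : Set Hil) :=
  dense_domain_of_schwartz fun f => ⟨_, mem_graph_cOp 0 0 j f⟩

/-- The shift changes sign because C̄ = -D. -/
theorem mem_graph_aOp_adjoint (A B : ℝ) (j : Fin 2) (f : 𝓢(Plane, ℂ)) :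
    (embed f, embed (hi A B (-1) j f)) ∈ (aOp A B j)†.graph := by
  rw [mem_graph_adjoint_iff (dense_domain_aOp A B j)]
  intro u v huv
  obtain ⟨_, hv, rfl⟩ := exists_of_mem_graph_smul huv
  obtain ⟨_, w, hv', hw, rfl⟩ := mem_graph_add_iff.1 hv
  obtain ⟨v₁, _, hv₁, hv₂', rfl⟩ := mem_graph_add_iff.1 hv'
  obtain ⟨v₂, hv₂, rfl⟩ := exists_of_mem_graph_smul hv₂'
  obtain rfl := mem_graph_scalarOp_iff.1 hw
  simp only [hi_apply, map_smul, map_add, map_sub, inner_smul_left, inner_smul_right,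
    inner_add_left, inner_add_right, inner_sub_right, inner_xOp hv₁, inner_pOp hv₂,
    conj_one_div_sqrt_two, conj_constC, Complex.conj_I]
  push_cast
  ring

theorem mem_graph_bOp_adjoint (A B : ℝ) (j : Fin 2) (f : 𝓢(Plane, ℂ)) :
    (embed f, embed (lo A B (-1) j f)) ∈ (bOp A B j)†.graph := by
  rw [mem_graph_adjoint_iff (dense_domain_bOp A B j)]
  intro u v huv
  obtain ⟨_, hv, rfl⟩ := exists_of_mem_graph_smul huv
  obtain ⟨_, w, hv', hw, rfl⟩ := mem_graph_add_iff.1 hv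
  obtain ⟨v₁, _, hv₁, hv₂', rfl⟩ := exists_of_mem_graph_sub hv'
  obtain ⟨v₂, hv₂, rfl⟩ := exists_of_mem_graph_smul hv₂'
  obtain rfl := mem_graph_scalarOp_iff.1 hw
  simp only [lo_apply, map_smul, map_add, inner_smul_left, inner_smul_right,
    inner_add_left, inner_add_right, inner_sub_left, inner_xOp hv₁, inner_pOp hv₂,
    conj_one_div_sqrt_two, conj_constD, Complex.conj_I]
  push_cast
  ring

theorem mem_graph_cOp_adjoint (A B : ℝ) (j : Fin 2) (f : 𝓢(Plane, ℂ)) :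
    (embed f, embed (hi A B 0 j f)) ∈ (cOp j)†.graph := by
  rw [mem_graph_adjoint_iff (dense_domain_cOp j)]
  intro u v huv
  obtain ⟨_, hv, rfl⟩ := exists_of_mem_graph_smul huv
  obtain ⟨v₁, _, hv₁, hv₂', rfl⟩ := mem_graph_add_iff.1 hv
  obtain ⟨v₂, hv₂, rfl⟩ := exists_of_mem_graph_smul hv₂'
  simp only [hi_apply, map_smul, map_add, map_sub, inner_smul_left, inner_smul_right,
    inner_add_left, inner_add_right, inner_sub_right, inner_xOp hv₁, inner_pOp hv₂,
    conj_one_div_sqrt_two, Complex.conj_I]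
  push_cast
  ring

theorem mem_graph_num (A B : ℝ) (j : Fin 2) (f : 𝓢(Plane, ℂ)) :
    (embed f, embed (hi A B 1 j (lo A B 1 j f))) ∈ (num A B j).graph :=
  mem_graph_opMul_iff.2 ⟨_, mem_graph_aOp A B j f, mem_graph_bOp A B j _⟩

theorem mem_graph_num_adjoint (A B : ℝ) (j : Fin 2) (f : 𝓢(Plane, ℂ)) :
    (embed f, embed (hi A B (-1) j (lo A B (-1) j f))) ∈ (num A B j)†.graph :=
  mem_graph_adjoint_opMul (dense_domain_bOp A B j) (dense_domain_aOp A B j)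
    (dense_domain_of_schwartz fun f => ⟨_, mem_graph_num A B j f⟩)
    (mem_graph_bOp_adjoint A B j f) (mem_graph_aOp_adjoint A B j _)

theorem stableUnder_map_embed {S : Submodule ℂ 𝓢(Plane, ℂ)} {L : Hil →ₗ.[ℂ] Hil}
    {ℓ : 𝓢(Plane, ℂ) → 𝓢(Plane, ℂ)} (hL : ∀ f, (embed f, embed (ℓ f)) ∈ L.graph)
    (hS : ∀ f ∈ S, ℓ f ∈ S) : StableUnder (S.map embed) L := by
  rintro _ ⟨f, hf, rfl⟩
  exact ⟨embed (ℓ f), ⟨_, hS f hf, rfl⟩, hL f⟩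

theorem lo_mem {S : Submodule ℂ 𝓢(Plane, ℂ)} (hx : ∀ j, ∀ f ∈ S, xS j f ∈ S)
    (hp : ∀ j, ∀ f ∈ S, pS j f ∈ S) (A B s : ℝ) (j : Fin 2) : ∀ f ∈ S, lo A B s j f ∈ S :=
  fun f hf => S.smul_mem _ (S.add_mem (S.add_mem (hx j f hf) (S.smul_mem _ (hp j f hf)))
    (S.smul_mem _ hf))

theorem hi_mem {S : Submodule ℂ 𝓢(Plane, ℂ)} (hx : ∀ j, ∀ f ∈ S, xS j f ∈ S)
    (hp : ∀ j, ∀ f ∈ S, pS j f ∈ S) (A B s : ℝ) (j : Fin 2) : ∀ f ∈ S, hi A B s j f ∈ S :=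
  fun f hf => S.smul_mem _ (S.add_mem (S.sub_mem (hx j f hf) (S.smul_mem _ (hp j f hf)))
    (S.smul_mem _ hf))

/-- `a_j`, `b_j` are pseudo-bosonic on every dense space of Schwartz functions that is stable under
positions and momenta. -/
theorem isPseudoBosonic_map_embed (A B : ℝ) {S : Submodule ℂ 𝓢(Plane, ℂ)}
    (hx : ∀ j, ∀ f ∈ S, xS j f ∈ S) (hp : ∀ j, ∀ f ∈ S, pS j f ∈ S)
    (hS : Dense (S.map embed : Set Hil)) :
    IsPseudoBosonic (S.map embed) (aOp A B) (bOp A B) where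
  dense := hS
  stable_a j := stableUnder_map_embed (mem_graph_aOp A B j) (lo_mem hx hp A B 1 j)
  stable_b j := stableUnder_map_embed (mem_graph_bOp A B j) (hi_mem hx hp A B 1 j)
  stable_a_adj j := stableUnder_map_embed (mem_graph_aOp_adjoint A B j) (hi_mem hx hp A B (-1) j)
  stable_b_adj j := stableUnder_map_embed (mem_graph_bOp_adjoint A B j) (lo_mem hx hp A B (-1) j)
  comm_ab j k := by
    rintro _ ⟨f, -, rfl⟩
    have := mem_graph_sub
      (mem_graph_opMul_iff.2 ⟨_, mem_graph_bOp A B k f, mem_graph_aOp A B j _⟩)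
      (mem_graph_opMul_iff.2 ⟨_, mem_graph_aOp A B j f, mem_graph_bOp A B k _⟩)
    rwa [← map_sub, lo_hi, apply_ite embed, map_zero] at this
  comm_aa j k := by
    rintro _ ⟨f, -, rfl⟩
    have := mem_graph_sub
      (mem_graph_opMul_iff.2 ⟨_, mem_graph_aOp A B k f, mem_graph_aOp A B j _⟩)
      (mem_graph_opMul_iff.2 ⟨_, mem_graph_aOp A B j f, mem_graph_aOp A B k _⟩)
    rwa [lo_comm, sub_self] at this
  comm_bb j k := by
    rintro _ ⟨f, -, rfl⟩
    have := mem_graph_sub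
      (mem_graph_opMul_iff.2 ⟨_, mem_graph_bOp A B k f, mem_graph_bOp A B j _⟩)
      (mem_graph_opMul_iff.2 ⟨_, mem_graph_bOp A B j f, mem_graph_bOp A B k _⟩)
    rwa [hi_comm, sub_self] at this

theorem schwartz_eq_map : schwartz = (⊤ : Submodule ℂ 𝓢(Plane, ℂ)).map embed :=
  LinearMap.range_eq_map embed

theorem isPseudoBosonic_schwartz (A B : ℝ) : IsPseudoBosonic schwartz (aOp A B) (bOp A B) := by
  have h := dense_schwartz
  rw [schwartz_eq_map] at h ⊢
  exact isPseudoBosonic_map_embed A B (fun _ _ _ => trivial) (fun _ _ _ => trivial) h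

/-- Expanding b_j a_j with C + D = 2iA, D - C = 2B and CD = -(A² + B²) gives ½(p_j² + x_j²) + iAx_j
+ iBp_j - ½ - ½(A² + B²); the ½ comes from the commutator [x_j, p_j] = i. -/
theorem hamiltonian_eq_num (A B : ℝ) : ∀ f ∈ schwartz, ∃ g, (f, g) ∈ (hamiltonian A B).graph ∧
    (f, g) ∈ (num A B 0 + num A B 1 + scalarOp ((A : ℂ) ^ 2 + (B : ℂ) ^ 2 + 1)).graph := by
  rintro _ ⟨f, rfl⟩
  have hpp (j : Fin 2) := mem_graph_opMul_iff.2 ⟨_, mem_graph_pOp j f, mem_graph_pOp j _⟩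
  have hxx (j : Fin 2) := mem_graph_opMul_iff.2 ⟨_, mem_graph_xOp j f, mem_graph_xOp j _⟩
  have hH := mem_graph_add (mem_graph_add
    (mem_graph_smul (1 / 2 : ℂ) (mem_graph_add (hpp 0) (hxx 0)))
    (mem_graph_smul (1 / 2 : ℂ) (mem_graph_add (hpp 1) (hxx 1))))
    (mem_graph_smul Complex.I (mem_graph_add
      (mem_graph_smul (A : ℂ) (mem_graph_add (mem_graph_xOp 0 f) (mem_graph_xOp 1 f)))
      (mem_graph_smul (B : ℂ) (mem_graph_add (mem_graph_pOp 0 f) (mem_graph_pOp 1 f)))))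
  have hN := mem_graph_add (mem_graph_add (mem_graph_num A B 0 f) (mem_graph_num A B 1 f))
    (mem_graph_scalarOp_iff (c := (A : ℂ) ^ 2 + (B : ℂ) ^ 2 + 1).2 rfl)
  refine ⟨_, hH, ?_⟩
  convert! hN using 2
  simp only [← map_smul, ← map_add]
  congr 1
  have hr := one_div_sqrt_two_mul_self
  have hI := Complex.I_mul_I
  clear hH hN hpp hxx
  simp only [lo_apply, hi_apply, map_smul, map_add, pS_xS, if_true, constC, constD,
    Complex.ofReal_one, one_mul]
  generalize (1 / (√2 : ℝ) : ℂ) = r at *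
  ext y
  simp only [add_apply, sub_apply, smul_apply, smul_eq_mul, xS_apply]
  generalize Complex.I = i at *
  generalize (A : ℂ) = a at *
  generalize (B : ℂ) = b at *
  generalize (y 0 : ℂ) = y₀ at *
  generalize (y 1 : ℂ) = y₁ at *
  generalize f y = f₀ at *
  generalize pS 0 f y = p at *
  generalize pS 1 f y = q at *
  generalize pS 0 (pS 0 f) y = pp at *
  generalize pS 1 (pS 1 f) y = qq at *
  linear_combination (-(y₀ ^ 2 + y₁ ^ 2 + 2 * i ^ 2 + 2 * i * a * (y₀ + y₁) +
    2 * (i ^ 2 * a ^ 2 - b ^ 2)) * f₀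
    + i ^ 2 * (pp + qq) - 2 * i * b * (p + q)) * hr -
    (1 / 2) * (2 * f₀ - pp - qq + 2 * a ^ 2 * f₀) * hI

/-! ### Vacua and towers -/

/-- `(n₁! n₂!)^{-1/2} ℓ₁^{n₁} ℓ₂^{n₂} f` on Schwartz functions. -/
def towerS (ℓ : Fin 2 → (𝓢(Plane, ℂ) →ₗ[ℂ] 𝓢(Plane, ℂ))) (f : 𝓢(Plane, ℂ)) (n : ℕ × ℕ) :
    𝓢(Plane, ℂ) :=
  (1 / (√(n.1.factorial * n.2.factorial) : ℝ) : ℂ) • (ℓ 0)^[n.1] ((ℓ 1)^[n.2] f)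

theorem app_iterate_embed {L : Hil →ₗ.[ℂ] Hil} {ℓ : 𝓢(Plane, ℂ) → 𝓢(Plane, ℂ)}
    (hL : ∀ f, (embed f, embed (ℓ f)) ∈ L.graph) (n : ℕ) (f : 𝓢(Plane, ℂ)) :
    (app L)^[n] (embed f) = embed (ℓ^[n] f) := by
  induction n generalizing f with
  | zero => rfl
  | succ n ih => rw [Function.iterate_succ_apply, Function.iterate_succ_apply,
      app_eq_of_mem_graph (hL f), ih]

theorem tower_embed {L : Fin 2 → (Hil →ₗ.[ℂ] Hil)}
    {ℓ : Fin 2 → (𝓢(Plane, ℂ) →ₗ[ℂ] 𝓢(Plane, ℂ))}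
    (hL : ∀ j f, (embed f, embed (ℓ j f)) ∈ (L j).graph) (f : 𝓢(Plane, ℂ)) (n : ℕ × ℕ) :
    tower L (embed f) n = embed (towerS ℓ f n) := by
  rw [tower, towerS, map_smul, app_iterate_embed (hL 1), app_iterate_embed (hL 0)]

theorem towerS_smul (ℓ : Fin 2 → (𝓢(Plane, ℂ) →ₗ[ℂ] 𝓢(Plane, ℂ))) (c : ℂ) (f : 𝓢(Plane, ℂ))
    (n : ℕ × ℕ) : towerS ℓ (c • f) n = c • towerS ℓ f n := by
  have key : ∀ (L : 𝓢(Plane, ℂ) →ₗ[ℂ] 𝓢(Plane, ℂ)) (m : ℕ) (h : 𝓢(Plane, ℂ)),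
      L^[m] (c • h) = c • L^[m] h := fun L m h => by
    rw [← Module.End.coe_pow, map_smul]
  rw [towerS, towerS, key, key, smul_comm]

theorem towerS_zero (ℓ : Fin 2 → (𝓢(Plane, ℂ) →ₗ[ℂ] 𝓢(Plane, ℂ))) (f : 𝓢(Plane, ℂ)) :
    towerS ℓ f 0 = f := by
  simp [towerS]

theorem towerS_induction (ℓ : Fin 2 → (𝓢(Plane, ℂ) →ₗ[ℂ] 𝓢(Plane, ℂ))) {S : Submodule ℂ 𝓢(Plane, ℂ)}
    (hS : ∀ j, ∀ f ∈ S, ℓ j f ∈ S) {f : 𝓢(Plane, ℂ)} (hf : f ∈ S) (n : ℕ × ℕ) :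
    towerS ℓ f n ∈ S := by
  have key : ∀ j m, ∀ h ∈ S, (ℓ j)^[m] h ∈ S := by
    intro j m
    induction m with
    | zero => exact fun h hh => hh
    | succ m ih =>
      intro h hh
      rw [Function.iterate_succ_apply]
      exact ih _ (hS j h hh)
  exact S.smul_mem _ (key 0 _ _ (key 1 _ _ hf))

/-- The Schwartz function `exp(-½(y₁²+y₂²) - s C (y₁+y₂))`. -/
def vac (A B s : ℝ) : 𝓢(Plane, ℂ) := gaussS 1 (by simp) fun _ => -(s * constC A B)

theorem gauss_eq_embed {A B s : ℝ} {k : ℂ} (hk : k = s * constC A B) (N : ℂ) :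
    gauss N k = embed (N • vac A B s) := by
  refine Lp.ext ((memLp_gaussFun N k).coeFn_toLp.trans (.trans ?_ (coeFn_embed _).symm))
  refine Filter.Eventually.of_forall fun y => ?_
  rw [smul_apply, vac, gaussS_apply, gaussFun, quad, hk, smul_eq_mul]
  congr 2
  ring

theorem lo_vac (A B s : ℝ) (j : Fin 2) : lo A B s j (vac A B s) = 0 := by
  have hI := Complex.I_mul_I
  ext y
  simp only [lo_apply, pS_apply, add_apply, smul_apply, smul_eq_mul, xS_apply, zero_apply, vac,
    dS_gaussS]
  linear_combination (-(1 / (√2 : ℝ) : ℂ) * (-1 * (y j : ℂ) - s * constC A B) *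
    gaussS 1 (by simp) (fun _ => -(s * constC A B)) y) * hI

/-- The vacuum of the lowering operators is unique. -/
theorem exists_eq_smul_vac {A B s : ℝ} {h : 𝓢(Plane, ℂ)} (hh : ∀ j, lo A B s j h = 0) :
    ∃ N : ℂ, h = N • vac A B s := by
  obtain ⟨N, hN⟩ := exists_eq_const_mul_exp_quad (h := h) (z := 1)
    (w := fun _ => -(s * constC A B)) fun j y => by
      have h1 := hh j
      rw [lo_apply, smul_eq_zero_iff_right one_div_sqrt_two_ne_zero] at h1
      have h2 := congrArg (fun u : 𝓢(Plane, ℂ) => u y) h1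
      simp only [pS_apply, add_apply, smul_apply, smul_eq_mul, xS_apply, zero_apply] at h2
      have hI := Complex.I_mul_I
      linear_combination h2 + dS j h y * hI
  exact ⟨N, SchwartzMap.ext fun y => hN y⟩

theorem phi_eq_embed (A B : ℝ) (N : ℂ) (n : ℕ × ℕ) :
    phi A B N n = embed (N • towerS (hi A B 1) (vac A B 1) n) := by
  rw [phi, gauss_eq_embed (A := A) (B := B) (s := 1) (by simp), tower_embed (mem_graph_bOp A B),
    towerS_smul]

theorem psi_eq_embed (A B : ℝ) (N : ℂ) (n : ℕ × ℕ) :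
    psi A B N n = embed (N • towerS (hi A B (-1)) (vac A B (-1)) n) := by
  rw [psi, gauss_eq_embed (A := A) (B := B) (s := -1) (by rw [conj_constD]; simp),
    tower_embed (mem_graph_aOp_adjoint A B), towerS_smul]

theorem bigPhi_eq_embed (A B : ℝ) (n : ℕ × ℕ) :
    bigPhi n = embed ((1 / (√Real.pi : ℝ) : ℂ) • towerS (hi A B 0) (vac A B 0) n) := by
  rw [bigPhi, gauss_eq_embed (A := A) (B := B) (s := 0) (by simp),
    tower_embed (mem_graph_cOp_adjoint A B), towerS_smul]

/-! ### Orthonormality of the oscillator eigenfunctions -/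

theorem inner_lo_zero (A B : ℝ) (j : Fin 2) (f g : 𝓢(Plane, ℂ)) :
    inner ℂ (embed (lo A B 0 j f)) (embed g) = inner ℂ (embed f) (embed (hi A B 0 j g)) :=
  (mem_graph_adjoint_iff (dense_domain_cOp j)).1 (mem_graph_cOp_adjoint A B j g) _ _
    (mem_graph_cOp A B j f)

theorem inner_hi_zero (A B : ℝ) (j : Fin 2) (f g : 𝓢(Plane, ℂ)) :
    inner ℂ (embed (hi A B 0 j f)) (embed g) = inner ℂ (embed f) (embed (lo A B 0 j g)) := by
  rw [← inner_conj_symm, ← inner_lo_zero, inner_conj_symm]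

theorem lo_hi_iterate_same (A B s : ℝ) (j : Fin 2) (m : ℕ) {f : 𝓢(Plane, ℂ)}
    (hf : lo A B s j f = 0) :
    lo A B s j ((hi A B s j)^[m + 1] f) = ((m : ℂ) + 1) • (hi A B s j)^[m] f := by
  have comm : ∀ g, lo A B s j (hi A B s j g) = hi A B s j (lo A B s j g) + g := fun g => by
    have := lo_hi A B s j j g
    rw [if_pos rfl, sub_eq_iff_eq_add] at this
    rw [this, add_comm]
  induction m with
  | zero =>
    rw [Function.iterate_one, Function.iterate_zero_apply, comm, hf, map_zero]
    simp
  | succ m ih =>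
    rw [Function.iterate_succ_apply', comm, ih, map_smul,
      Function.iterate_succ_apply' _ m]
    push_cast
    module

theorem lo_hi_iterate_of_ne (A B s : ℝ) {j k : Fin 2} (hjk : j ≠ k) (m : ℕ) (f : 𝓢(Plane, ℂ)) :
    lo A B s j ((hi A B s k)^[m] f) = (hi A B s k)^[m] (lo A B s j f) := by
  have : Function.Commute (lo A B s j) (hi A B s k) := fun g => by
    have := lo_hi A B s j k g
    rwa [if_neg hjk, sub_eq_zero] at this
  exact this.iterate_right m f

/-- One raising operator at a time moves across as a lowering operator, which acts on the n-th
excited state as n times the previous one and kills the vacuum. -/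
theorem inner_hi_iterate (A B : ℝ) (j : Fin 2) {f g : 𝓢(Plane, ℂ)} (hf : lo A B 0 j f = 0)
    (hg : lo A B 0 j g = 0) (m n : ℕ) :
    inner ℂ (embed ((hi A B 0 j)^[m] f)) (embed ((hi A B 0 j)^[n] g)) =
      if m = n then (m.factorial : ℂ) * inner ℂ (embed f) (embed g) else 0 := by
  induction m generalizing n with
  | zero =>
    cases n with
    | zero => simp
    | succ n =>
      rw [Function.iterate_succ_apply', ← inner_lo_zero, Function.iterate_zero_apply, hf]
      simp
  | succ m ih =>
    rw [Function.iterate_succ_apply', inner_hi_zero]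
    cases n with
    | zero =>
      rw [Function.iterate_zero_apply, hg]
      simp
    | succ n =>
      rw [lo_hi_iterate_same A B 0 j n hg, map_smul, inner_smul_right, ih]
      rcases eq_or_ne m n with rfl | hmn
      · simp only [if_true, Nat.factorial_succ]
        push_cast
        ring
      · simp [hmn]

/-- The normalised vacuum of the oscillator. -/
def vacNormalized : 𝓢(Plane, ℂ) := (1 / (√Real.pi : ℝ) : ℂ) • vac 0 0 0

theorem vacNormalized_apply (y : Plane) :
    vacNormalized y = ((1 / √Real.pi * Real.exp (-(1 / 2) * ‖y‖ ^ 2) : ℝ) : ℂ) := by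
  rw [vacNormalized, smul_apply, vac, gaussS_apply, quad, smul_eq_mul, plane_norm_sq]
  push_cast
  congr 2
  ring

theorem lo_vacNormalized (j : Fin 2) : lo 0 0 0 j vacNormalized = 0 := by
  rw [vacNormalized, map_smul, lo_vac, smul_zero]

theorem inner_vacNormalized : inner ℂ (embed vacNormalized) (embed vacNormalized) = 1 := by
  have h1 : ∀ y, starRingEnd ℂ (vacNormalized y) * vacNormalized y =
      ((1 / Real.pi * Real.exp (-1 * ‖y‖ ^ 2) : ℝ) : ℂ) := by
    intro y
    rw [vacNormalized_apply, Complex.conj_ofReal, ← Complex.ofReal_mul, mul_mul_mul_comm,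
      ← Real.exp_add, div_mul_div_comm, Real.mul_self_sqrt Real.pi_pos.le]
    ring_nf
  rw [inner_embed]
  simp only [h1]
  rw [integral_complex_ofReal, integral_const_mul,
    GaussianFourier.integral_rexp_neg_mul_sq_norm one_pos]
  have : (Module.finrank ℝ Plane : ℝ) = 2 := by simp
  rw [this]
  simp

/-- The oscillator eigenfunctions up to normalisation. -/
def hermiteS (m n : ℕ) : 𝓢(Plane, ℂ) := (hi 0 0 0 0)^[m] ((hi 0 0 0 1)^[n] vacNormalized)

theorem bigPhi_eq_hermiteS (n : ℕ × ℕ) : bigPhi n =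
    embed ((1 / (√(n.1.factorial * n.2.factorial) : ℝ) : ℂ) • hermiteS n.1 n.2) := by
  rw [bigPhi_eq_embed 0 0, ← towerS_smul]
  rfl

theorem inner_hermiteS (m n m' n' : ℕ) :
    inner ℂ (embed (hermiteS m n)) (embed (hermiteS m' n')) =
      if m = m' ∧ n = n' then (m.factorial * n.factorial : ℂ) else 0 := by
  have h0 : ∀ n, lo 0 0 0 0 ((hi 0 0 0 1)^[n] vacNormalized) = 0 := fun n => by
    rw [lo_hi_iterate_of_ne 0 0 0 (by decide), lo_vacNormalized, ← Module.End.coe_pow, map_zero]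
  rw [hermiteS, hermiteS, inner_hi_iterate 0 0 0 (h0 n) (h0 n'),
    inner_hi_iterate 0 0 1 (lo_vacNormalized 1) (lo_vacNormalized 1), inner_vacNormalized]
  by_cases h1 : m = m' <;> by_cases h2 : n = n' <;> simp [h1, h2]

theorem orthonormal_bigPhi : Orthonormal ℂ bigPhi := by
  rw [orthonormal_iff_ite]
  rintro ⟨m, n⟩ ⟨m', n'⟩
  rw [bigPhi_eq_hermiteS, bigPhi_eq_hermiteS, map_smul, map_smul, inner_smul_left, inner_smul_right,
    inner_hermiteS, map_div₀, map_one, Complex.conj_ofReal]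
  by_cases h : m = m' ∧ n = n'
  · obtain ⟨rfl, rfl⟩ := h
    simp only [and_self, if_true]
    rw [← mul_assoc, div_mul_div_comm, ← Complex.ofReal_mul, Real.mul_self_sqrt (by positivity)]
    have := Nat.factorial_ne_zero m
    have := Nat.factorial_ne_zero n
    push_cast
    field_simp
  · rw [if_neg h, if_neg (by simpa using h)]
    simp

/-! ### Completeness of the oscillator eigenfunctions -/

/-- A locally integrable function that is orthogonal to all real Schwartz functions vanishes. -/
theorem ae_eq_zero_of_integral_schwartz_mul {h : Plane → ℂ} (hh : LocallyIntegrable h volume)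
    (H : ∀ ψ : 𝓢(Plane, ℂ), (∀ y, starRingEnd ℂ (ψ y) = ψ y) → ∫ y, ψ y * h y = 0) :
    ∀ᵐ y, h y = 0 := by
  refine ae_eq_zero_of_integral_contDiff_smul_eq_zero hh fun g hg hgc => ?_
  have hc : HasCompactSupport fun y => (g y : ℂ) := hgc.comp_left Complex.ofReal_zero
  exact H (hc.toSchwartzMap (Complex.ofRealCLM.contDiff.comp hg)) fun y => Complex.conj_ofReal (g y)

/-- The span of the unnormalised oscillator eigenfunctions. -/
def hermiteSpan : Submodule ℂ 𝓢(Plane, ℂ) :=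
  Submodule.span ℂ (Set.range fun n : ℕ × ℕ => hermiteS n.1 n.2)

theorem hermiteS_mem (m n : ℕ) : hermiteS m n ∈ hermiteSpan :=
  Submodule.subset_span ⟨(m, n), rfl⟩

theorem map_mem_hermiteSpan {L : 𝓢(Plane, ℂ) →ₗ[ℂ] 𝓢(Plane, ℂ)}
    (hL : ∀ m n, L (hermiteS m n) ∈ hermiteSpan) : ∀ f ∈ hermiteSpan, L f ∈ hermiteSpan := by
  have : hermiteSpan ≤ hermiteSpan.comap L := by
    refine Submodule.span_le.2 ?_
    rintro _ ⟨n, rfl⟩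
    exact hL n.1 n.2
  exact this

theorem hi_mem_hermiteSpan (j : Fin 2) : ∀ f ∈ hermiteSpan, hi 0 0 0 j f ∈ hermiteSpan := by
  refine map_mem_hermiteSpan fun m n => ?_
  fin_cases j
  · have : hi 0 0 0 0 (hermiteS m n) = hermiteS (m + 1) n := by
      rw [hermiteS, hermiteS, Function.iterate_succ_apply']
    exact this ▸ hermiteS_mem _ _
  · have hc : Function.Commute (hi 0 0 0 1) (hi 0 0 0 0) := fun g => hi_comm 0 0 0 1 0 g
    have : hi 0 0 0 1 (hermiteS m n) = hermiteS m (n + 1) := by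
      rw [hermiteS, hermiteS, hc.iterate_right m, Function.iterate_succ_apply']
    exact this ▸ hermiteS_mem _ _

theorem lo_mem_hermiteSpan (j : Fin 2) : ∀ f ∈ hermiteSpan, lo 0 0 0 j f ∈ hermiteSpan := by
  refine map_mem_hermiteSpan fun m n => ?_
  fin_cases j
  · have h0 : lo 0 0 0 0 ((hi 0 0 0 1)^[n] vacNormalized) = 0 := by
      rw [lo_hi_iterate_of_ne 0 0 0 (by decide), lo_vacNormalized, ← Module.End.coe_pow, map_zero]
    change lo 0 0 0 0 (hermiteS m n) ∈ _
    cases m with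
    | zero =>
      rw [hermiteS, Function.iterate_zero_apply, h0]
      exact zero_mem _
    | succ m =>
      rw [hermiteS, lo_hi_iterate_same 0 0 0 0 m h0]
      exact Submodule.smul_mem _ _ (hermiteS_mem m n)
  · change lo 0 0 0 1 (hermiteS m n) ∈ _
    rw [hermiteS, lo_hi_iterate_of_ne 0 0 0 (by decide)]
    cases n with
    | zero =>
      rw [Function.iterate_zero_apply, lo_vacNormalized, ← Module.End.coe_pow, map_zero]
      exact zero_mem _
    | succ n =>
      rw [lo_hi_iterate_same 0 0 0 1 n (lo_vacNormalized 1), ← Module.End.coe_pow, map_smul,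
        Module.End.coe_pow]
      exact Submodule.smul_mem _ _ (hermiteS_mem m n)

/-- At shift 0, x_j is the sum of the lowering and raising operators divided by √2. -/
theorem xS_mem_hermiteSpan (j : Fin 2) : ∀ f ∈ hermiteSpan, xS j f ∈ hermiteSpan := by
  intro f hf
  have h := hermiteSpan.smul_mem (1 / (√2 : ℝ) : ℂ)
    (hermiteSpan.add_mem (lo_mem_hermiteSpan j f hf) (hi_mem_hermiteSpan j f hf))
  convert! h using 1
  have hr := one_div_sqrt_two_mul_self
  rw [lo_apply, hi_apply]
  generalize (1 / (√2 : ℝ) : ℂ) = r at *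
  ext y
  simp only [add_apply, sub_apply, smul_apply, smul_eq_mul, Complex.ofReal_zero, zero_mul]
  linear_combination (-2 * xS j f y) * hr

theorem exists_mem_hermiteSpan_pow (t : Fin 2 → ℝ) (n : ℕ) : ∃ w ∈ hermiteSpan, ∀ y : Plane,
    w y = ((t 0 * y 0 + t 1 * y 1 : ℝ) : ℂ) ^ n * vacNormalized y := by
  induction n with
  | zero => exact ⟨vacNormalized, hermiteS_mem 0 0, fun y => by simp⟩
  | succ n ih =>
    obtain ⟨w, hw, h⟩ := ih
    refine ⟨(t 0 : ℂ) • xS 0 w + (t 1 : ℂ) • xS 1 w, hermiteSpan.add_mem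
      (hermiteSpan.smul_mem _ (xS_mem_hermiteSpan 0 w hw))
      (hermiteSpan.smul_mem _ (xS_mem_hermiteSpan 1 w hw)), fun y => ?_⟩
    simp only [add_apply, smul_apply, smul_eq_mul, xS_apply, h]
    push_cast
    ring

theorem integrable_schwartz_mul (w : 𝓢(Plane, ℂ)) (f : Hil) :
    Integrable (fun y => w y * f y) volume :=
  (w.memLp 2 volume).integrable_mul (Lp.memLp f)

theorem inner_embed_left (w : 𝓢(Plane, ℂ)) (f : Hil) :
    inner ℂ (embed w) f = ∫ y, starRingEnd ℂ (w y) * f y := by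
  rw [L2.inner_def]
  refine integral_congr_ae ?_
  filter_upwards [coeFn_embed w] with y hy
  rw [hy, RCLike.inner_apply, mul_comm]

/-- The Gaussian weight `exp(|t·y|)` is integrable against products of the vacuum and an
`L²` function. -/
theorem integrable_exp_abs_mul (t : Fin 2 → ℝ) (f : Hil) : Integrable
    (fun y : Plane => Real.exp |t 0 * y 0 + t 1 * y 1| * ‖vacNormalized y * f y‖) volume := by
  -- The vacuum times e^{s t·y} is again a Gaussian Schwartz function, so its product with an L²
  -- function is integrable. The cases s = ±1 dominate e^{|t·y|}.
  have key (s : ℝ) : Integrable (fun y : Plane => Real.exp (s * (t 0 * y 0 + t 1 * y 1)) *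
      ‖vacNormalized y * f y‖) volume := by
    have h := ((integrable_schwartz_mul (gaussS 1 (by simp) fun j =>
      ((s * t j : ℝ) : ℂ)) f).norm).const_mul (1 / √Real.pi)
    refine h.congr (Filter.Eventually.of_forall fun y => ?_)
    simp only [norm_mul, gaussS_apply, Complex.norm_exp, quad_re, vacNormalized_apply,
      Complex.norm_real, Real.norm_eq_abs, Complex.ofReal_re, Complex.one_re]
    rw [abs_of_pos (by positivity), Real.abs_exp, Real.exp_add]
    have : s * t 0 * y 0 + s * t 1 * y 1 = s * (t 0 * y 0 + t 1 * y 1) := by ring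
    rw [this]
    ring
  refine ((key 1).add (key (-1))).mono' ?_ (Filter.Eventually.of_forall fun y => ?_)
  · exact (Continuous.aestronglyMeasurable (by fun_prop)).mul
      (integrable_schwartz_mul vacNormalized f).norm.aestronglyMeasurable
  · rw [Real.norm_eq_abs, abs_of_nonneg (by positivity), Pi.add_apply, ← add_mul]
    gcongr
    rcases abs_cases (t 0 * y 0 + t 1 * y 1) with ⟨h, -⟩ | ⟨h, -⟩
    · rw [h, one_mul]
      exact le_add_of_nonneg_right (Real.exp_pos _).le
    · rw [h, neg_one_mul]
      exact le_add_of_nonneg_left (Real.exp_pos _).le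

/-- The character is expanded in its exponential series. Each term pairs f with a power of t·y times
the vacuum, which lies in the Hermite span; e^{|t·y|} dominates and allows integration term by term.
-/
theorem integral_exp_mul_eq_zero {f : Hil} (hf : ∀ w ∈ hermiteSpan, inner ℂ (embed w) f = 0)
    (t : Fin 2 → ℝ) : ∫ y : Plane, Complex.exp (((t 0 * y 0 + t 1 * y 1 : ℝ) : ℂ) * Complex.I) *
      (vacNormalized y * f y) = 0 := by
  have hint : ∀ n : ℕ, ∫ y : Plane, (((t 0 * y 0 + t 1 * y 1 : ℝ) : ℂ) * Complex.I) ^ n /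
      n.factorial * (vacNormalized y * f y) = 0 := by
    intro n
    obtain ⟨w, hw, hwy⟩ := exists_mem_hermiteSpan_pow t n
    have h := hf w hw
    rw [inner_embed_left] at h
    have : ∀ y : Plane, (((t 0 * y 0 + t 1 * y 1 : ℝ) : ℂ) * Complex.I) ^ n /
        n.factorial * (vacNormalized y * f y) =
        (Complex.I ^ n / n.factorial) * (starRingEnd ℂ (w y) * f y) := by
      intro y
      rw [hwy, vacNormalized_apply, map_mul, map_pow, Complex.conj_ofReal, Complex.conj_ofReal]
      ring
    simp only [this]
    rw [integral_const_mul, h, mul_zero]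
  have hexp : ∀ r : ℝ, HasSum (fun n : ℕ => |r| ^ n / n.factorial) (Real.exp |r|) := fun r => by
    rw [Real.exp_eq_exp_ℝ]
    exact NormedSpace.expSeries_div_hasSum_exp |r|
  have hexpC : ∀ z : ℂ, HasSum (fun n : ℕ => z ^ n / n.factorial) (Complex.exp z) := fun z => by
    rw [Complex.exp_eq_exp_ℂ]
    exact NormedSpace.expSeries_div_hasSum_exp z
  have hsum := hasSum_integral_of_dominated_convergence (μ := (volume : Measure Plane))
    (F := fun (n : ℕ) (y : Plane) => (((t 0 * y 0 + t 1 * y 1 : ℝ) : ℂ) * Complex.I) ^ n /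
      n.factorial * (vacNormalized y * f y))
    (f := fun y => Complex.exp (((t 0 * y 0 + t 1 * y 1 : ℝ) : ℂ) * Complex.I) *
      (vacNormalized y * f y))
    (fun n y => |t 0 * y 0 + t 1 * y 1| ^ n / n.factorial * ‖vacNormalized y * f y‖)
    (fun n => (Continuous.aestronglyMeasurable (by fun_prop)).mul
      (integrable_schwartz_mul vacNormalized f).aestronglyMeasurable)
    (fun n => Filter.Eventually.of_forall fun y => by
      rw [norm_mul, norm_div, norm_pow, norm_mul, Complex.norm_I, mul_one, Complex.norm_real,
        Real.norm_eq_abs, Complex.norm_natCast])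
    (Filter.Eventually.of_forall fun y => ((hexp _).mul_right _).summable)
    ((integrable_exp_abs_mul t f).congr (Filter.Eventually.of_forall fun y =>
      ((hexp _).mul_right _).tsum_eq.symm))
    (Filter.Eventually.of_forall fun y => (hexpC _).mul_right _)
  simp only [hint] at hsum
  exact hsum.unique hasSum_zero

/-- The integrable function vacuum · f has vanishing Fourier transform, hence vanishes a.e.; the
vacuum has no zeros. -/
theorem eq_zero_of_inner_hermiteSpan {f : Hil}
    (hf : ∀ w ∈ hermiteSpan, inner ℂ (embed w) f = 0) : f = 0 := by
  have hint := integrable_schwartz_mul vacNormalized f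
  have hF : ∀ ξ : Plane, FourierTransform.fourier (fun y => vacNormalized y * f y) ξ = 0 := by
    intro ξ
    rw [Real.fourier_eq', ← integral_exp_mul_eq_zero hf fun j => -2 * Real.pi * ξ j]
    refine integral_congr_ae (Filter.Eventually.of_forall fun y => ?_)
    simp only [smul_eq_mul]
    congr 3
    rw [PiLp.inner_apply, Fin.sum_univ_two]
    simp
    ring
  have hzero : ∀ᵐ y, vacNormalized y * f y = 0 := by
    refine ae_eq_zero_of_integral_schwartz_mul hint.locallyIntegrable fun ψ _ => ?_
    -- Every Schwartz test function is a Fourier transform, so the transform can be moved onto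
    -- vacuum · f, where it is zero.
    obtain ⟨χ, rfl⟩ : ∃ χ : 𝓢(Plane, ℂ), FourierTransform.fourier χ = ψ :=
      ⟨FourierTransformInv.fourierInv ψ, by simp⟩
    have h : ∫ ξ, FourierTransform.fourier χ ξ • (vacNormalized ξ * f ξ) =
        ∫ x, χ x • FourierTransform.fourier (fun y => vacNormalized y * f y) x := by
      simpa using! VectorFourier.integral_fourierIntegral_smul_eq_flip (μ := volume) (ν := volume)
        (L := innerₗ Plane) Real.continuous_fourierChar continuous_inner χ.integrable hint
    simp only [hF, smul_zero, integral_zero] at h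
    exact h
  refine (Lp.eq_zero_iff_ae_eq_zero).2 ?_
  filter_upwards [hzero] with y hy
  refine (mul_eq_zero.1 hy).resolve_left ?_
  have := Real.pi_pos
  rw [vacNormalized_apply]
  exact Complex.ofReal_ne_zero.2 (by positivity)

theorem exists_hilbertBasis_bigPhi : ∃ e : HilbertBasis (ℕ × ℕ) ℂ Hil, ∀ n, e n = bigPhi n := by
  refine ⟨HilbertBasis.mkOfOrthogonalEqBot orthonormal_bigPhi ?_, fun n => by
    rw [HilbertBasis.coe_mkOfOrthogonalEqBot]⟩
  rw [Submodule.eq_bot_iff]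
  intro f hf
  refine eq_zero_of_inner_hermiteSpan fun w hw => ?_
  have hle : hermiteSpan.map embed ≤ Submodule.span ℂ (Set.range bigPhi) := by
    rw [hermiteSpan, Submodule.map_span, Submodule.span_le]
    rintro _ ⟨_, ⟨n, rfl⟩, rfl⟩
    have hn : embed (hermiteS n.1 n.2) =
        ((√(n.1.factorial * n.2.factorial) : ℝ) : ℂ) • bigPhi n := by
      rw [bigPhi_eq_hermiteS, map_smul, smul_smul, mul_one_div_cancel, one_smul]
      rw [Complex.ofReal_ne_zero]
      positivity
    exact hn ▸ Submodule.smul_mem _ _ (Submodule.subset_span ⟨n, rfl⟩)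
  exact (Submodule.mem_orthogonal _ _).1 hf _ (hle ⟨w, hw, rfl⟩)

/-! ### Schwartz functions are a core of multiplication operators -/

/-- Membership in the graph of multiplication by a function of temperate growth can be tested on
Schwartz functions. -/
theorem mem_graph_mulOp_of_schwartz {g : Plane → ℝ} (hg : (fun y => (g y : ℂ)).HasTemperateGrowth)
    {f h : Hil} (H : ∀ w w' : 𝓢(Plane, ℂ), (∀ y, w' y = g y * w y) →
      inner ℂ (embed w) h = inner ℂ (embed w') f) : (f, h) ∈ (mulOp volume g).graph := by
  have hgc : Continuous fun y => (g y : ℂ) := hg.1.continuous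
  have hf1 : LocallyIntegrable (f : Plane → ℂ) volume :=
    (Lp.memLp f).locallyIntegrable (by norm_num)
  have hh1 : LocallyIntegrable (h : Plane → ℂ) volume :=
    (Lp.memLp h).locallyIntegrable (by norm_num)
  have hgf : LocallyIntegrable (fun y => (g y : ℂ) * f y) volume := hf1.continuous_mul hgc
  have h0 : ∀ᵐ y, h y - (g y : ℂ) * f y = 0 := by
    refine ae_eq_zero_of_integral_schwartz_mul (hh1.sub hgf) fun ψ hψ => ?_
    set ψ' : 𝓢(Plane, ℂ) := SchwartzMap.smulLeftCLM ℂ (fun y => (g y : ℂ)) ψ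
    have hψ' : ∀ y, ψ' y = g y * ψ y := SchwartzMap.smulLeftCLM_apply_apply hg ψ
    have h1 := H ψ ψ' hψ'
    rw [inner_embed_left, inner_embed_left] at h1
    have h2 : ∫ y, ψ y * h y = ∫ y, ψ' y * f y := by
      simpa only [hψ, hψ', map_mul, Complex.conj_ofReal] using h1
    rw [← sub_eq_zero, ← integral_sub (integrable_schwartz_mul ψ h)
      (integrable_schwartz_mul ψ' f)] at h2
    rw [← h2]
    refine integral_congr_ae (Filter.Eventually.of_forall fun y => ?_)
    simp only [hψ']
    ring
  rw [mem_graph_mulOp_iff]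
  filter_upwards [h0] with y hy
  exact sub_eq_zero.1 hy

theorem norm_sq_add_I_smul {E : Type*} [NormedAddCommGroup E] [InnerProductSpace ℂ E] {f h : E}
    (hfh : inner ℂ h f = inner ℂ f h) : ‖h + Complex.I • f‖ ^ 2 = ‖h‖ ^ 2 + ‖f‖ ^ 2 := by
  have him : (inner ℂ h f).im = 0 := by
    rw [← Complex.conj_eq_iff_im, inner_conj_symm, hfh]
  rw [@norm_add_sq ℂ, inner_smul_right, norm_smul, Complex.norm_I]
  simp [him]

/-- Schwartz functions are a core of multiplication by a function of temperate growth. -/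
theorem mem_closure_schwartz_graph {g : Plane → ℝ}
    (hg : (fun y => (g y : ℂ)).HasTemperateGrowth) {f h : Hil}
    (hfh : (f, h) ∈ (mulOp volume g).graph) :
    (f, h) ∈ closure {p : Hil × Hil | ∃ w w' : 𝓢(Plane, ℂ), (∀ y, w' y = g y * w y) ∧
      p = (embed w, embed w')} := by
  set M : 𝓢(Plane, ℂ) →ₗ[ℂ] 𝓢(Plane, ℂ) :=
    (SchwartzMap.smulLeftCLM ℂ fun y => (g y : ℂ)).toLinearMap
  have hM : ∀ w y, M w y = g y * w y := fun w y => SchwartzMap.smulLeftCLM_apply_apply hg w y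
  have hgc : Continuous g := by
    have : Continuous fun y => (g y : ℂ).re := Complex.continuous_re.comp hg.1.continuous
    simpa using this
  have hMg : ∀ w, (embed w, embed (M w)) ∈ (mulOp volume g).graph := fun w =>
    (mem_graph_mulOp_embed_iff hgc).2 (hM w)
  -- The classical criterion: 𝒮 is a core once (g + i)𝒮 is dense. A vector orthogonal to this range
  -- satisfies g k = i k, impossible for real g unless k = 0.
  have hdense : Dense (LinearMap.range (embed ∘ₗ (M + Complex.I • LinearMap.id)) : Set Hil) := by
    rw [Submodule.dense_iff_topologicalClosure_eq_top, Submodule.topologicalClosure_eq_top_iff,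
      Submodule.eq_bot_iff]
    intro k hk
    have h1 : (k, Complex.I • k) ∈ (mulOp volume g).graph := by
      refine mem_graph_mulOp_of_schwartz hg fun w w' hw => ?_
      obtain rfl : w' = M w := SchwartzMap.ext fun y => by rw [hw, hM]
      have h2 := (Submodule.mem_orthogonal _ _).1 hk _ ⟨w, rfl⟩
      simp only [LinearMap.comp_apply, LinearMap.add_apply, LinearMap.smul_apply,
        LinearMap.id_apply, map_add, map_smul, inner_add_left, inner_smul_left,
        Complex.conj_I] at h2
      rw [inner_smul_right]
      linear_combination -h2
    rw [mem_graph_mulOp_iff] at h1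
    rw [Lp.eq_zero_iff_ae_eq_zero]
    filter_upwards [h1, Lp.coeFn_smul Complex.I k] with y h2 h3
    rw [h3, Pi.smul_apply, smul_eq_mul, ← sub_eq_zero, ← sub_mul] at h2
    refine (mul_eq_zero.1 h2).resolve_left fun h4 => ?_
    have := congrArg Complex.im h4
    simp at this
  rw [Metric.mem_closure_iff]
  intro ε hε
  obtain ⟨_, ⟨w, rfl⟩, hw⟩ := Metric.mem_closure_iff.1 (hdense (h + Complex.I • f)) ε hε
  refine ⟨(embed w, embed (M w)), ⟨w, M w, hM w, rfl⟩, ?_⟩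
  have hsub : (f - embed w, h - embed (M w)) ∈ (mulOp volume g).graph :=
    (mulOp volume g).graph.sub_mem hfh (hMg w)
  -- Since ‖(g + i)u‖² = ‖gu‖² + ‖u‖², approximating (g + i)f approximates f and g f simultaneously.
  have hn := norm_sq_add_I_smul (inner_mulOp_comm hsub hsub)
  have heq : h - embed (M w) + Complex.I • (f - embed w) = h + Complex.I • f -
      (embed ∘ₗ (M + Complex.I • LinearMap.id)) w := by
    simp only [LinearMap.comp_apply, LinearMap.add_apply, LinearMap.smul_apply,
      LinearMap.id_apply, map_add, map_smul]
    module
  rw [heq, ← dist_eq_norm, ← dist_eq_norm, ← dist_eq_norm] at hn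
  have h1 : dist f (embed w) < ε := by
    refine (abs_le_of_sq_le_sq' ?_ dist_nonneg).2.trans_lt hw
    rw [hn]
    exact le_add_of_nonneg_left (sq_nonneg _)
  have h2 : dist h (embed (M w)) < ε := by
    refine (abs_le_of_sq_le_sq' ?_ dist_nonneg).2.trans_lt hw
    rw [hn]
    exact le_add_of_nonneg_right (sq_nonneg _)
  exact max_lt h1 h2

/-! ### Diagonalisation of the generator -/

/-- A unitary map of `L²(ℝ²)` that preserves `𝒮(ℝ²)`, acts on positions and momenta as a linear
canonical transformation, and turns `-A(p₁+p₂) + B(x₁+x₂)` into multiplication by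
`c(y₁+y₂)`. -/
structure Diagonalization (A B : ℝ) where
  /-- The map on Schwartz functions. -/
  V : 𝓢(Plane, ℂ) ≃ₗ[ℂ] 𝓢(Plane, ℂ)
  /-- The unitary map. -/
  U : Hil ≃ₗᵢ[ℂ] Hil
  U_embed : ∀ f, U (embed f) = embed (V f)
  /-- The slope of the multiplier. -/
  c : ℝ
  /-- The position part of the transformed position. -/
  xx : ℂ
  /-- The derivative part of the transformed position. -/
  xd : ℂ
  /-- The position part of the transformed momentum. -/
  px : ℂ
  /-- The derivative part of the transformed momentum. -/
  pd : ℂ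
  V_xS : ∀ j f, V (xS j f) = xx • xS j (V f) + xd • dS j (V f)
  V_pS : ∀ j f, V (pS j f) = px • xS j (V f) + pd • dS j (V f)
  -- Only the derivative parts notice the weight e^{tc(y₁+y₂)}, so these two products fix the shifts
  -- t·iA and t·iB of position and momentum.
  xd_mul : xd * c = -(Complex.I * A)
  pd_mul : pd * c = -(Complex.I * B)
  mult_eq : -A * px + B * xx = c
  deriv_eq : -A * pd + B * xd = 0
  -- This quotient is the width z of the Gaussian exp(-z|y|²/2) that spans the image of the
  -- oscillator vacuum.
  re_pos : 0 < ((xx + Complex.I * px) / (xd + Complex.I * pd)).re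

theorem denseRange_embed : DenseRange embed := dense_schwartz

/-- A bijection of `𝒮(ℝ²)` that preserves the `L²` norm, extended to `L²(ℝ²)`. -/
def extendUnitary (V : 𝓢(Plane, ℂ) ≃ₗ[ℂ] 𝓢(Plane, ℂ)) (hV : ∀ f, ‖embed (V f)‖ = ‖embed f‖) :
    Hil ≃ₗᵢ[ℂ] Hil :=
  V.extendOfIsometry embed embed denseRange_embed denseRange_embed hV

theorem extendUnitary_embed {V : 𝓢(Plane, ℂ) ≃ₗ[ℂ] 𝓢(Plane, ℂ)}
    {hV : ∀ f, ‖embed (V f)‖ = ‖embed f‖} (f : 𝓢(Plane, ℂ)) :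
    extendUnitary V hV (embed f) = embed (V f) :=
  LinearEquiv.extendOfIsometry_eq V embed embed denseRange_embed denseRange_embed hV f

theorem hasTemperateGrowth_chirp (r : ℝ) :
    (fun y => Complex.exp (quad (Complex.I * r) 0 y)).HasTemperateGrowth :=
  hasTemperateGrowth_cexp (hasTemperateGrowth_quad _ _) fun y => by rw [quad_re]; simp

/-- Multiplication by the chirp `exp(-i r (y₁²+y₂²)/2)`. -/
def chirpS (r : ℝ) : 𝓢(Plane, ℂ) →ₗ[ℂ] 𝓢(Plane, ℂ) :=
  (SchwartzMap.smulLeftCLM ℂ fun y => Complex.exp (quad (Complex.I * r) 0 y)).toLinearMap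

theorem chirpS_apply (r : ℝ) (f : 𝓢(Plane, ℂ)) (y : Plane) :
    chirpS r f y = Complex.exp (quad (Complex.I * r) 0 y) * f y :=
  SchwartzMap.smulLeftCLM_apply_apply (hasTemperateGrowth_chirp r) f y

theorem chirpS_neg (r : ℝ) (f : 𝓢(Plane, ℂ)) : chirpS (-r) (chirpS r f) = f := by
  ext y
  rw [chirpS_apply, chirpS_apply, ← mul_assoc, ← Complex.exp_add]
  have : quad (Complex.I * (-r : ℝ)) 0 y + quad (Complex.I * r) 0 y = 0 := by
    simp only [quad, Complex.ofReal_neg, Pi.zero_apply]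
    ring
  rw [this, Complex.exp_zero, one_mul]

/-- Multiplication by the chirp `exp(-i r (y₁²+y₂²)/2)`, as an equivalence. -/
def chirpEquiv (r : ℝ) : 𝓢(Plane, ℂ) ≃ₗ[ℂ] 𝓢(Plane, ℂ) :=
  { chirpS r with
    invFun := chirpS (-r)
    left_inv := chirpS_neg r
    right_inv := fun f => by
      have := chirpS_neg (-r) f
      rwa [neg_neg] at this }

theorem norm_embed_chirpS (r : ℝ) (f : 𝓢(Plane, ℂ)) : ‖embed (chirpS r f)‖ = ‖embed f‖ := by
  have h : ∀ y, starRingEnd ℂ (chirpS r f y) * chirpS r f y = starRingEnd ℂ (f y) * f y := by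
    intro y
    have hn : ‖chirpS r f y‖ = ‖f y‖ := by
      rw [chirpS_apply, norm_mul, Complex.norm_exp, quad_re]
      simp
    rw [Complex.conj_mul', Complex.conj_mul', hn]
  have : inner ℂ (embed (chirpS r f)) (embed (chirpS r f)) = inner ℂ (embed f) (embed f) := by
    rw [inner_embed, inner_embed]
    simp only [h]
  simp_rw [norm_eq_sqrt_re_inner (𝕜 := ℂ), this]

theorem chirpS_xS (r : ℝ) (j : Fin 2) (f : 𝓢(Plane, ℂ)) :
    chirpS r (xS j f) = xS j (chirpS r f) := by
  ext y
  simp only [chirpS_apply, xS_apply]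
  ring

/-- In terms of momenta, conjugation by the chirp replaces p_j by p_j + r x_j. -/
theorem chirpS_dS (r : ℝ) (j : Fin 2) (f : 𝓢(Plane, ℂ)) :
    chirpS r (dS j f) = dS j (chirpS r f) + (Complex.I * r) • xS j (chirpS r f) := by
  ext y
  have h : HasFDerivAt (chirpS r f) _ y :=
    ((hasFDerivAt_quad (Complex.I * r) 0 y).cexp.mul
      f.differentiableAt.hasFDerivAt).congr_of_eventuallyEq
      (Filter.Eventually.of_forall fun y => chirpS_apply r f y)
  rw [add_apply, dS_eq_of_hasFDerivAt h, add_apply, smul_apply, smul_apply, smul_apply, smul_apply,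
    quad_lineDeriv, xS_apply, chirpS_apply, chirpS_apply, dS_apply]
  simp only [smul_eq_mul, Pi.zero_apply]
  ring

theorem smulLeftCLM_inner_single (j : Fin 2) (f : 𝓢(Plane, ℂ)) :
    SchwartzMap.smulLeftCLM ℂ (inner ℝ · (EuclideanSpace.single j (1 : ℝ))) f = xS j f := by
  have h : (inner ℝ · (EuclideanSpace.single j (1 : ℝ)) : Plane → ℝ).HasTemperateGrowth := by
    fun_prop
  ext y
  rw [SchwartzMap.smulLeftCLM_apply_apply h, xS_apply, EuclideanSpace.inner_single_right]
  simp

/-- The Fourier transform on `𝒮(ℝ²)`. -/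
def fourierS : 𝓢(Plane, ℂ) ≃ₗ[ℂ] 𝓢(Plane, ℂ) := FourierTransform.fourierEquiv ℂ 𝓢(Plane, ℂ)

theorem fourierS_dS (j : Fin 2) (f : 𝓢(Plane, ℂ)) :
    fourierS (dS j f) = (2 * Real.pi * Complex.I) • xS j (fourierS f) := by
  rw [← smulLeftCLM_inner_single]
  exact SchwartzMap.fourier_lineDerivOp_eq f (EuclideanSpace.single j (1 : ℝ))

theorem dS_fourierS (j : Fin 2) (f : 𝓢(Plane, ℂ)) :
    dS j (fourierS f) = -(2 * Real.pi * Complex.I) • fourierS (xS j f) := by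
  rw [← smulLeftCLM_inner_single, ← map_smul]
  exact SchwartzMap.lineDerivOp_fourier_eq f (EuclideanSpace.single j (1 : ℝ))

theorem two_pi_ne_zero : (2 * Real.pi : ℂ) ≠ 0 := by
  simp [Real.pi_ne_zero]

theorem fourierS_xS (j : Fin 2) (f : 𝓢(Plane, ℂ)) :
    fourierS (xS j f) = (Complex.I / (2 * Real.pi)) • dS j (fourierS f) := by
  have h : Complex.I / (2 * Real.pi) * -(2 * Real.pi * Complex.I) = 1 := by
    have := two_pi_ne_zero
    field_simp
    simp
  rw [dS_fourierS, smul_smul, h, one_smul]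

/-- The generator `B(x₁+x₂)` is diagonal. -/
def diagonalizationZero (B : ℝ) : Diagonalization 0 B where
  V := LinearEquiv.refl ℂ _
  U := LinearIsometryEquiv.refl ℂ _
  U_embed _ := rfl
  c := B
  xx := 1
  xd := 0
  px := 0
  pd := -Complex.I
  V_xS j f := by simp
  V_pS j f := by simp [pS_apply]
  xd_mul := by simp
  pd_mul := by simp
  mult_eq := by simp
  deriv_eq := by simp
  re_pos := by simp

/-- The generator with `A ≠ 0` is diagonalised by a chirp and the Fourier transform. -/
def diagonalizationOfNe {A : ℝ} (hA : A ≠ 0) (B : ℝ) : Diagonalization A B where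
  -- With r = B/A the chirp turns -Ap_j + Bx_j into -Ap_j. The Fourier transform, with kernel
  -- e^{-2πi y·ξ}, then turns p_j into 2πy_j, whence c = -2πA.
  V := (chirpEquiv (B / A)).trans fourierS
  U := extendUnitary ((chirpEquiv (B / A)).trans fourierS) fun f =>
    (SchwartzMap.norm_fourier_toL2_eq (chirpS (B / A) f)).trans (norm_embed_chirpS _ f)
  U_embed f := extendUnitary_embed f
  c := -2 * Real.pi * A
  xx := 0
  xd := Complex.I / (2 * Real.pi)
  px := 2 * Real.pi
  pd := (B / A) * (Complex.I / (2 * Real.pi))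
  V_xS j f := by
    change fourierS (chirpS (B / A) (xS j f)) =
      _ • xS j (fourierS (chirpS (B / A) f)) + _ • dS j (fourierS (chirpS (B / A) f))
    rw [chirpS_xS, fourierS_xS, zero_smul, zero_add]
  V_pS j f := by
    change fourierS (chirpS (B / A) (pS j f)) =
      _ • xS j (fourierS (chirpS (B / A) f)) + _ • dS j (fourierS (chirpS (B / A) f))
    rw [pS_apply, map_smul, chirpS_dS, map_smul, map_add, map_smul, fourierS_xS, fourierS_dS]
    have hI := Complex.I_mul_I
    ext y
    simp only [add_apply, smul_apply, smul_eq_mul]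
    push_cast
    linear_combination (-(2 * Real.pi * xS j (fourierS (chirpS (B / A) f)) y) -
      B / A * (Complex.I / (2 * Real.pi)) * dS j (fourierS (chirpS (B / A) f)) y) * hI
  xd_mul := by
    have := two_pi_ne_zero
    push_cast
    field_simp
  pd_mul := by
    have := two_pi_ne_zero
    have : (A : ℂ) ≠ 0 := Complex.ofReal_ne_zero.2 hA
    push_cast
    field_simp
  mult_eq := by
    push_cast
    ring
  deriv_eq := by
    have : (A : ℂ) ≠ 0 := Complex.ofReal_ne_zero.2 hA
    field_simp
    ring
  re_pos := by
    have hr : (1 : ℂ) + Complex.I * (B / A : ℝ) ≠ 0 := fun h => by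
      simpa using congrArg Complex.re h
    have hr' : (1 : ℂ) + ((B / A : ℝ) : ℂ) ^ 2 ≠ 0 := by
      rw [← Complex.ofReal_pow, ← Complex.ofReal_one, ← Complex.ofReal_add, Complex.ofReal_ne_zero]
      positivity
    have hden : Complex.I / (2 * Real.pi) + Complex.I * ((B / A) * (Complex.I / (2 * Real.pi))) =
        Complex.I / (2 * Real.pi) * (1 + Complex.I * (B / A : ℝ)) := by
      push_cast
      ring
    -- The quotient is 4π²/(1 + ir) with r = B/A, whose real part is 4π²/(1 + r²).
    have heq : (0 + Complex.I * (2 * Real.pi)) /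
        (Complex.I / (2 * Real.pi) + Complex.I * ((B / A) * (Complex.I / (2 * Real.pi)))) =
        ((4 * Real.pi ^ 2 / (1 + (B / A) ^ 2) : ℝ) : ℂ) * (1 - Complex.I * (B / A : ℝ)) := by
      rw [hden, div_eq_iff (mul_ne_zero (div_ne_zero Complex.I_ne_zero two_pi_ne_zero) hr)]
      have h2 := two_pi_ne_zero
      have hI := Complex.I_sq
      generalize B / A = r at *
      push_cast
      field_simp
      linear_combination (4 * Complex.I * Real.pi * r ^ 2) * hI
    rw [heq, Complex.re_ofReal_mul]
    have := Real.pi_pos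
    simp
    positivity

theorem nonempty_diagonalization (A B : ℝ) : Nonempty (Diagonalization A B) := by
  rcases eq_or_ne A 0 with rfl | hA
  · exact ⟨diagonalizationZero B⟩
  · exact ⟨diagonalizationOfNe hA B⟩

namespace Diagonalization

variable {A B : ℝ} (D : Diagonalization A B)

/-! ### The exponentials of the generator -/

/-- The multiplier `c(y₁+y₂)`. -/
def mult (y : Plane) : ℝ := D.c * (y 0 + y 1)

theorem continuous_mult : Continuous D.mult := by
  unfold mult
  fun_prop

theorem measurable_exp_mult (t : ℝ) : Measurable fun y => Real.exp (t * D.mult y) :=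
  (Real.continuous_exp.comp (continuous_const.mul D.continuous_mult)).measurable

/-- The operator `exp(t K)`, where `K` is the generator. -/
def expOp (t : ℝ) : Hil →ₗ.[ℂ] Hil :=
  pullback D.U (mulOp volume fun y => Real.exp (t * D.mult y))

theorem isSelfAdjoint_expOp (t : ℝ) : IsSelfAdjoint (D.expOp t) :=
  isSelfAdjoint_pullback D.U (isSelfAdjoint_mulOp (D.measurable_exp_mult t))

theorem mem_graph_expOp_iff {t : ℝ} {f h : Hil} : (f, h) ∈ (D.expOp t).graph ↔
    D.U h =ᵐ[volume] fun y => ((Real.exp (t * D.mult y) : ℝ) : ℂ) * D.U f y := by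
  rw [expOp, mem_graph_pullback_iff, mem_graph_mulOp_iff]

theorem mem_graph_expOp_embed_iff {t : ℝ} {f h : 𝓢(Plane, ℂ)} :
    (embed f, embed h) ∈ (D.expOp t).graph ↔
      ∀ y, D.V h y = ((Real.exp (t * D.mult y) : ℝ) : ℂ) * D.V f y := by
  rw [expOp, mem_graph_pullback_iff, D.U_embed, D.U_embed, mem_graph_mulOp_embed_iff]
  exact Real.continuous_exp.comp (continuous_const.mul D.continuous_mult)

theorem inner_expOp_comm {t : ℝ} {f h u v : Hil} (hfh : (f, h) ∈ (D.expOp t).graph)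
    (huv : (u, v) ∈ (D.expOp t).graph) : inner ℂ v f = inner ℂ u h := by
  rw [← D.U.inner_map_map, ← D.U.inner_map_map u]
  exact inner_mulOp_comm (mem_graph_pullback_iff.1 hfh) (mem_graph_pullback_iff.1 huv)

theorem mem_graph_expOp_trans {s t : ℝ} {f g h : Hil} (hfg : (f, g) ∈ (D.expOp s).graph)
    (hgh : (g, h) ∈ (D.expOp t).graph) : (f, h) ∈ (D.expOp (s + t)).graph := by
  rw [mem_graph_expOp_iff] at *
  filter_upwards [hfg, hgh] with y h1 h2
  rw [h2, h1, add_mul, Real.exp_add]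
  push_cast
  ring

theorem mem_graph_expOp_symm {t : ℝ} {f g : Hil} (hfg : (f, g) ∈ (D.expOp t).graph) :
    (g, f) ∈ (D.expOp (-t)).graph := by
  rw [mem_graph_expOp_iff] at *
  filter_upwards [hfg] with y h1
  rw [h1, ← mul_assoc, ← Complex.ofReal_mul, ← Real.exp_add]
  simp

theorem mem_graph_expOp_neg_iff {t : ℝ} {f g : Hil} :
    (g, f) ∈ (D.expOp (-t)).graph ↔ (f, g) ∈ (D.expOp t).graph :=
  ⟨fun h => by simpa using D.mem_graph_expOp_symm h, D.mem_graph_expOp_symm⟩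

theorem ker_expOp (t : ℝ) : LinearMap.ker (D.expOp t).toFun = ⊥ :=
  ker_eq_bot_of_graph fun _ hf =>
    LinearPMap.graph_fst_eq_zero_snd _ (D.mem_graph_expOp_symm hf) rfl

theorem inverse_expOp (t : ℝ) : (D.expOp t).inverse = D.expOp (-t) :=
  graph_ext fun f g => by rw [mem_graph_inverse_iff (D.ker_expOp t), mem_graph_expOp_neg_iff]

/-- The natural domain of the product loses nothing: u ≤ 1 + u² for u = e^{t·mult} shows that f and
u²f in L² force uf in L². -/
theorem opMul_expOp (t : ℝ) : opMul (D.expOp t) (D.expOp t) = D.expOp (t + t) := by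
  refine graph_ext fun f h => ⟨fun hfh => ?_, fun hfh => ?_⟩
  · obtain ⟨g, hfg, hgh⟩ := mem_graph_opMul_iff.1 hfh
    exact D.mem_graph_expOp_trans hfg hgh
  · have hmem : MemLp (fun y => ((Real.exp (t * D.mult y) : ℝ) : ℂ) * D.U f y) 2 volume := by
      refine MemLp.mono' (g := fun y => ‖D.U f y‖ + ‖D.U h y‖)
        ((Lp.memLp (D.U f)).norm.add (Lp.memLp (D.U h)).norm)
        ((Complex.measurable_ofReal.comp (D.measurable_exp_mult t)).aestronglyMeasurable.mul
          (Lp.aestronglyMeasurable _)) ?_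
      filter_upwards [D.mem_graph_expOp_iff.1 hfh] with y hy
      rw [hy, norm_mul, norm_mul, Complex.norm_real, Complex.norm_real, Real.norm_eq_abs,
        Real.norm_eq_abs, Real.abs_exp, Real.abs_exp, add_mul, Real.exp_add, ← one_add_mul]
      gcongr
      nlinarith [sq_nonneg (Real.exp (t * D.mult y) - 1), Real.exp_pos (t * D.mult y)]
    have hfg : (f, D.U.symm (hmem.toLp _)) ∈ (D.expOp t).graph := by
      rw [mem_graph_expOp_iff, D.U.apply_symm_apply]
      exact hmem.coeFn_toLp
    refine mem_graph_opMul_iff.2 ⟨_, hfg, ?_⟩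
    have := D.mem_graph_expOp_trans (D.mem_graph_expOp_symm hfg) hfh
    rwa [neg_add_cancel_left] at this

/-! ### The generator -/

/-- The generator on Schwartz functions. -/
def genS (A B : ℝ) : 𝓢(Plane, ℂ) →ₗ[ℂ] 𝓢(Plane, ℂ) :=
  (-A : ℂ) • (pS 0 + pS 1) + (B : ℂ) • (xS 0 + xS 1)

theorem mem_graph_genS (A B : ℝ) (f : 𝓢(Plane, ℂ)) : (embed f, embed (genS A B f)) ∈
    ((-A : ℂ) • (pOp 0 + pOp 1) + (B : ℂ) • (xOp 0 + xOp 1)).graph := by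
  have := mem_graph_add
    (mem_graph_smul (-A : ℂ) (mem_graph_add (mem_graph_pOp 0 f) (mem_graph_pOp 1 f)))
    (mem_graph_smul (B : ℂ) (mem_graph_add (mem_graph_xOp 0 f) (mem_graph_xOp 1 f)))
  rw [← map_add, ← map_add, ← map_smul, ← map_smul, ← map_add] at this
  exact this

theorem inner_genS {A B : ℝ} {u v : Hil} (huv : (u, v) ∈
    ((-A : ℂ) • (pOp 0 + pOp 1) + (B : ℂ) • (xOp 0 + xOp 1)).graph) (f : 𝓢(Plane, ℂ)) :
    inner ℂ v (embed f) = inner ℂ u (embed (genS A B f)) := by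
  obtain ⟨_, _, h1, h2, rfl⟩ := mem_graph_add_iff.1 huv
  obtain ⟨_, h3, rfl⟩ := exists_of_mem_graph_smul h1
  obtain ⟨_, h4, rfl⟩ := exists_of_mem_graph_smul h2
  obtain ⟨p₀, p₁, hp₀, hp₁, rfl⟩ := mem_graph_add_iff.1 h3
  obtain ⟨x₀, x₁, hx₀, hx₁, rfl⟩ := mem_graph_add_iff.1 h4
  simp only [genS, LinearMap.add_apply, LinearMap.smul_apply, map_add, map_smul, inner_add_left,
    inner_add_right, inner_smul_left, inner_smul_right, inner_pOp hp₀, inner_pOp hp₁,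
    inner_xOp hx₀, inner_xOp hx₁, map_neg, Complex.conj_ofReal]

theorem V_genS (t : ℝ) (f : 𝓢(Plane, ℂ)) (y : Plane) :
    D.V (genS (t * A) (t * B) f) y = ((t * D.mult y : ℝ) : ℂ) * D.V f y := by
  simp only [genS, LinearMap.add_apply, LinearMap.smul_apply, map_add, map_smul, D.V_pS, D.V_xS,
    add_apply, smul_apply, smul_eq_mul, xS_apply, mult]
  push_cast
  linear_combination (t * (y 0 + y 1) * D.V f y) * D.mult_eq +
    (t * (dS 0 (D.V f) y + dS 1 (D.V f) y)) * D.deriv_eq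

theorem hasTemperateGrowth_mult (t : ℝ) :
    (fun y => ((t * D.mult y : ℝ) : ℂ)).HasTemperateGrowth := by
  have : (fun y => ((t * D.mult y : ℝ) : ℂ)) = quad 0 fun _ => ((t * D.c : ℝ) : ℂ) := by
    funext y
    simp only [mult, quad]
    push_cast
    ring
  rw [this]
  exact hasTemperateGrowth_quad _ _

/-- The generator is unitarily equivalent to multiplication by a linear function. -/
theorem mem_graph_generator_iff (t : ℝ) {f h : Hil} :
    (f, h) ∈ (generator (t * A) (t * B)).graph ↔
      (D.U f, D.U h) ∈ (mulOp volume fun y => t * D.mult y).graph := by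
  have hle : ∀ f h, (f, h) ∈ ((-(t * A : ℝ) : ℂ) • (pOp 0 + pOp 1) +
      ((t * B : ℝ) : ℂ) • (xOp 0 + xOp 1)).graph →
      (D.U f, D.U h) ∈ (mulOp volume fun y => t * D.mult y).graph := by
    intro f h hfh
    refine mem_graph_mulOp_of_schwartz (D.hasTemperateGrowth_mult t) fun w w' hw => ?_
    obtain ⟨u, rfl⟩ := D.V.surjective w
    obtain rfl : w' = D.V (genS (t * A) (t * B) u) := SchwartzMap.ext fun y => by
      rw [hw, V_genS]
    rw [← D.U_embed, ← D.U_embed, D.U.inner_map_map, D.U.inner_map_map, ← inner_conj_symm,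
      inner_genS hfh, inner_conj_symm]
  have hclosed : (pullback D.U (mulOp volume fun y => t * D.mult y)).IsClosed :=
    (isSelfAdjoint_pullback D.U (isSelfAdjoint_mulOp
      (continuous_const.mul D.continuous_mult).measurable)).isClosed
  have hle' : ((-(t * A : ℝ) : ℂ) • (pOp 0 + pOp 1) + ((t * B : ℝ) : ℂ) • (xOp 0 + xOp 1)) ≤
      pullback D.U (mulOp volume fun y => t * D.mult y) :=
    LinearPMap.le_of_le_graph fun ⟨f, h⟩ hfh => mem_graph_pullback_iff.2 (hle f h hfh)
  have hclosable := hclosed.isClosable.leIsClosable hle'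
  rw [generator, ← hclosable.graph_closure_eq_closure_graph, ← mem_graph_pullback_iff]
  constructor
  · intro hfh
    exact closure_minimal (LinearPMap.le_graph_of_le hle') hclosed hfh
  -- Since V maps 𝒮 onto 𝒮, the Schwartz core of the multiplication operator pulls back to Schwartz
  -- functions, on which the operator sum is already defined.
  · intro hfh
    have h1 := mem_closure_schwartz_graph (D.hasTemperateGrowth_mult t)
      (mem_graph_pullback_iff.1 hfh)
    have h2 : Continuous fun p : Hil × Hil => (D.U.symm p.1, D.U.symm p.2) := by fun_prop
    have h3 := map_mem_closure h2 h1 (t := ((((-(t * A : ℝ) : ℂ) • (pOp 0 + pOp 1) +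
      ((t * B : ℝ) : ℂ) • (xOp 0 + xOp 1)).graph : Submodule ℂ (Hil × Hil)) : Set (Hil × Hil))) ?_
    · simp only [D.U.symm_apply_apply] at h3
      exact h3
    · rintro _ ⟨w, w', hw, rfl⟩
      obtain ⟨u, rfl⟩ := D.V.surjective w
      obtain rfl : w' = D.V (genS (t * A) (t * B) u) := SchwartzMap.ext fun y => by
        rw [hw, V_genS]
      simp only [← D.U_embed, D.U.symm_apply_apply]
      exact mem_graph_genS _ _ u

theorem isFunctionOf_expOp (t : ℝ) :
    IsFunctionOf Real.exp (generator (t * A) (t * B)) (D.expOp t) :=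
  ⟨Plane, inferInstance, volume, inferInstance, fun y => t * D.mult y, D.U,
    (continuous_const.mul D.continuous_mult).measurable,
    fun _ _ => D.mem_graph_generator_iff t, fun _ _ => mem_graph_pullback_iff⟩

/-! ### Commutation of the exponentials with the ladder operators -/

theorem dS_V_of_mem_graph {t : ℝ} {f h : 𝓢(Plane, ℂ)}
    (hfh : (embed f, embed h) ∈ (D.expOp t).graph) (j : Fin 2) (y : Plane) :
    dS j (D.V h) y = ((Real.exp (t * D.mult y) : ℝ) : ℂ) *
      (dS j (D.V f) y + t * D.c * D.V f y) := by
  have hexp : ∀ y, ((Real.exp (t * D.mult y) : ℝ) : ℂ) =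
      Complex.exp (quad 0 (fun _ => t * D.c) y) := fun y => by
    rw [Complex.ofReal_exp, mult, quad]
    push_cast
    congr 1
    ring
  have h : HasFDerivAt (D.V h) _ y :=
    ((hasFDerivAt_quad 0 (fun _ => t * D.c) y).cexp.mul
      (D.V f).differentiableAt.hasFDerivAt).congr_of_eventuallyEq
      (Filter.Eventually.of_forall fun y => by
        rw [D.mem_graph_expOp_embed_iff.1 hfh, hexp, Pi.mul_apply])
  have hq := quad_lineDeriv 0 (fun _ => (t * D.c : ℂ)) y j
  beta_reduce at hq
  rw [dS_eq_of_hasFDerivAt h, add_apply, smul_apply, smul_apply, smul_apply, hq, hexp, dS_apply]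
  simp only [smul_eq_mul]
  ring

/-- This is e^{tK} x_j = (x_j + t·iA) e^{tK}: after diagonalisation ∂_j falls on the weight and
yields the factor tc, and xd · c = -iA. -/
theorem mem_graph_expOp_xS {t : ℝ} {f h : 𝓢(Plane, ℂ)}
    (hfh : (embed f, embed h) ∈ (D.expOp t).graph) (j : Fin 2) :
    (embed (xS j f), embed (xS j h + (t * (Complex.I * A)) • h)) ∈ (D.expOp t).graph := by
  rw [mem_graph_expOp_embed_iff]
  intro y
  have h1 := D.mem_graph_expOp_embed_iff.1 hfh y
  simp only [map_add, map_smul, D.V_xS, add_apply, smul_apply, smul_eq_mul, xS_apply,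
    D.dS_V_of_mem_graph hfh, h1]
  linear_combination (t * ((Real.exp (t * D.mult y) : ℝ) : ℂ) * D.V f y) * D.xd_mul

theorem mem_graph_expOp_pS {t : ℝ} {f h : 𝓢(Plane, ℂ)}
    (hfh : (embed f, embed h) ∈ (D.expOp t).graph) (j : Fin 2) :
    (embed (pS j f), embed (pS j h + (t * (Complex.I * B)) • h)) ∈ (D.expOp t).graph := by
  rw [mem_graph_expOp_embed_iff]
  intro y
  have h1 := D.mem_graph_expOp_embed_iff.1 hfh y
  simp only [map_add, map_smul, D.V_pS, add_apply, smul_apply, smul_eq_mul, xS_apply,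
    D.dS_V_of_mem_graph hfh, h1]
  linear_combination (t * ((Real.exp (t * D.mult y) : ℝ) : ℂ) * D.V f y) * D.pd_mul

theorem mem_graph_expOp_smul {t : ℝ} {f h : 𝓢(Plane, ℂ)} (c : ℂ)
    (hfh : (embed f, embed h) ∈ (D.expOp t).graph) :
    (embed (c • f), embed (c • h)) ∈ (D.expOp t).graph := by
  rw [map_smul, map_smul]
  exact (D.expOp t).graph.smul_mem c hfh

theorem mem_graph_expOp_add {t : ℝ} {f h f' h' : 𝓢(Plane, ℂ)}
    (hfh : (embed f, embed h) ∈ (D.expOp t).graph)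
    (hfh' : (embed f', embed h') ∈ (D.expOp t).graph) :
    (embed (f + f'), embed (h + h')) ∈ (D.expOp t).graph := by
  rw [map_add, map_add]
  exact (D.expOp t).graph.add_mem hfh hfh'

/-- The shifts of x_j and i p_j add up to t(iA + i·iB) = tC. -/
theorem mem_graph_expOp_lo {t : ℝ} {f h : 𝓢(Plane, ℂ)}
    (hfh : (embed f, embed h) ∈ (D.expOp t).graph) (s : ℝ) (j : Fin 2) :
    (embed (lo A B s j f), embed (lo A B (s + t) j h)) ∈ (D.expOp t).graph := by
  have key := D.mem_graph_expOp_smul (1 / (√2 : ℝ) : ℂ) (D.mem_graph_expOp_add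
    (D.mem_graph_expOp_add (D.mem_graph_expOp_xS hfh j)
      (D.mem_graph_expOp_smul Complex.I (D.mem_graph_expOp_pS hfh j)))
    (D.mem_graph_expOp_smul (s * constC A B) hfh))
  convert! key using 3
  rw [lo_apply]
  congr 1
  have hI := Complex.I_mul_I
  ext y
  simp only [add_apply, smul_apply, smul_eq_mul, constC]
  push_cast
  linear_combination (-(t * B * h y)) * hI

/-- Here the shifts add up to t(iA - i·iB) = tD. -/
theorem mem_graph_expOp_hi {t : ℝ} {f h : 𝓢(Plane, ℂ)}
    (hfh : (embed f, embed h) ∈ (D.expOp t).graph) (s : ℝ) (j : Fin 2) :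
    (embed (hi A B s j f), embed (hi A B (s + t) j h)) ∈ (D.expOp t).graph := by
  have key := D.mem_graph_expOp_smul (1 / (√2 : ℝ) : ℂ) (D.mem_graph_expOp_add
    (D.mem_graph_expOp_add (D.mem_graph_expOp_xS hfh j)
      (D.mem_graph_expOp_smul (-Complex.I) (D.mem_graph_expOp_pS hfh j)))
    (D.mem_graph_expOp_smul (s * constD A B) hfh))
  convert! key using 3
  · rw [hi_apply, sub_eq_add_neg, neg_smul]
  · rw [hi_apply]
    congr 1
    have hI := Complex.I_mul_I
    ext y
    simp only [add_apply, sub_apply, smul_apply, smul_eq_mul, constD]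
    push_cast
    linear_combination (t * B * h y) * hI

theorem mem_graph_expOp_towerS {t : ℝ} {f h : 𝓢(Plane, ℂ)}
    (hfh : (embed f, embed h) ∈ (D.expOp t).graph) (s : ℝ) (n : ℕ × ℕ) :
    (embed (towerS (hi A B s) f n), embed (towerS (hi A B (s + t)) h n)) ∈ (D.expOp t).graph := by
  have key : ∀ j m, ∀ f h : 𝓢(Plane, ℂ), (embed f, embed h) ∈ (D.expOp t).graph →
      (embed ((hi A B s j)^[m] f), embed ((hi A B (s + t) j)^[m] h)) ∈ (D.expOp t).graph := by
    intro j m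
    induction m with
    | zero => exact fun f h hfh => hfh
    | succ m ih =>
      intro f h hfh
      rw [Function.iterate_succ_apply, Function.iterate_succ_apply]
      exact ih _ _ (D.mem_graph_expOp_hi hfh s j)
  exact D.mem_graph_expOp_smul _ (key 0 _ _ _ (key 1 _ _ _ hfh))

/-! ### The exponentials of the vacuum -/

/-- The image under V of the equations c_j vac = 0 is a first-order system ∂_j h = -z y_j h, solved
only by Gaussians. No explicit Fourier integral is needed. -/
theorem exists_V_vac : ∃ (z : ℂ) (N : ℂ), 0 < z.re ∧
    ∀ y, D.V (vac A B 0) y = N * Complex.exp (quad z 0 y) := by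
  set κ := D.xd + Complex.I * D.pd with hκ
  have hre := D.re_pos
  have hκ0 : κ ≠ 0 := by
    intro h
    rw [← hκ, h, div_zero] at hre
    simp at hre
  obtain ⟨N, hN⟩ := exists_eq_const_mul_exp_quad (h := D.V (vac A B 0))
    (z := (D.xx + Complex.I * D.px) / κ) (w := 0) fun j y => by
      have h1 := lo_vac A B 0 j
      rw [lo_apply, smul_eq_zero_iff_right one_div_sqrt_two_ne_zero, Complex.ofReal_zero, zero_mul,
        zero_smul, add_zero] at h1
      have h2 := congrArg (fun u => D.V u y) h1
      simp only [map_add, map_smul, D.V_xS, D.V_pS, add_apply, smul_apply, smul_eq_mul, xS_apply,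
        map_zero, zero_apply] at h2
      rw [Pi.zero_apply, add_zero]
      field_simp
      linear_combination h2 + dS j (D.V (vac A B 0)) y * hκ
  exact ⟨_, N, hre, hN⟩

/-- The weight adds a linear term to the exponent of the Gaussian, so the result is Schwartz. It is
annihilated by `lo` at shift t, and uniqueness of the vacuum identifies it. -/
theorem exists_mem_graph_expOp_vac (t : ℝ) :
    ∃ N : ℂ, (embed (vac A B 0), embed (N • vac A B t)) ∈ (D.expOp t).graph := by
  obtain ⟨z, N, hz, hN⟩ := D.exists_V_vac
  set h : 𝓢(Plane, ℂ) := D.V.symm (N • gaussS z hz fun _ => ((t * D.c : ℝ) : ℂ)) with hh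
  have hmem : (embed (vac A B 0), embed h) ∈ (D.expOp t).graph := by
    rw [mem_graph_expOp_embed_iff]
    intro y
    rw [hN, hh, D.V.apply_symm_apply, smul_apply, gaussS_apply, smul_eq_mul, mul_left_comm,
      Complex.ofReal_exp, ← Complex.exp_add]
    congr 2
    simp only [quad, mult, Pi.zero_apply]
    push_cast
    ring
  obtain ⟨N', hN'⟩ := exists_eq_smul_vac (A := A) (B := B) (s := t) (h := h) fun j => by
    have h1 := D.mem_graph_expOp_lo hmem 0 j
    rw [lo_vac, map_zero, zero_add] at h1
    exact embed_injective ((LinearPMap.graph_fst_eq_zero_snd _ h1 rfl).trans (map_zero embed).symm)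
  exact ⟨N', hN' ▸ hmem⟩

/-! ### The invariant space of Schwartz functions -/

/-- The Schwartz functions that all `exp(t K)` map to Schwartz functions. -/
def invS : Submodule ℂ 𝓢(Plane, ℂ) where
  carrier := {f | ∀ t, ∃ h, (embed f, embed h) ∈ (D.expOp t).graph}
  add_mem' := fun hf hg t => by
    obtain ⟨h, hh⟩ := hf t
    obtain ⟨k, hk⟩ := hg t
    exact ⟨h + k, D.mem_graph_expOp_add hh hk⟩
  zero_mem' := fun t => ⟨0, by
    rw [map_zero]
    exact (D.expOp t).graph.zero_mem⟩
  smul_mem' := fun c f hf t => by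
    obtain ⟨h, hh⟩ := hf t
    exact ⟨c • h, D.mem_graph_expOp_smul c hh⟩

theorem xS_mem_invS (j : Fin 2) : ∀ f ∈ D.invS, xS j f ∈ D.invS := fun _ hf t => by
  obtain ⟨h, hh⟩ := hf t
  exact ⟨_, D.mem_graph_expOp_xS hh j⟩

theorem pS_mem_invS (j : Fin 2) : ∀ f ∈ D.invS, pS j f ∈ D.invS := fun _ hf t => by
  obtain ⟨h, hh⟩ := hf t
  exact ⟨_, D.mem_graph_expOp_pS hh j⟩

theorem mem_invS_of_mem_graph {s : ℝ} {f h : 𝓢(Plane, ℂ)} (hf : f ∈ D.invS)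
    (hfh : (embed f, embed h) ∈ (D.expOp s).graph) : h ∈ D.invS := fun t => by
  obtain ⟨k, hk⟩ := hf (s + t)
  have := D.mem_graph_expOp_trans (D.mem_graph_expOp_symm hfh) hk
  rw [neg_add_cancel_left] at this
  exact ⟨k, this⟩

theorem stableUnder_expOp (t : ℝ) : StableUnder (D.invS.map embed) (D.expOp t) := by
  rintro _ ⟨f, hf, rfl⟩
  obtain ⟨h, hh⟩ := hf t
  exact ⟨embed h, ⟨h, D.mem_invS_of_mem_graph hf hh, rfl⟩, hh⟩

theorem vac_zero_mem_invS : vac A B 0 ∈ D.invS := fun t => by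
  obtain ⟨N, hN⟩ := D.exists_mem_graph_expOp_vac t
  exact ⟨_, hN⟩

theorem embed_ne_zero_vac : embed (vac A B 0) ≠ 0 := by
  intro h
  have h1 : vac A B 0 = 0 := embed_injective (h.trans (map_zero embed).symm)
  have h2 := congrArg (fun u : 𝓢(Plane, ℂ) => u 0) h1
  exact Complex.exp_ne_zero _ h2

/-- A multiple of this vacuum is e^{sK} of the oscillator vacuum, and the factor is nonzero because
e^{sK} is injective. -/
theorem vac_mem_invS (s : ℝ) : vac A B s ∈ D.invS := by
  obtain ⟨N, hN⟩ := D.exists_mem_graph_expOp_vac s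
  have h1 := D.mem_invS_of_mem_graph D.vac_zero_mem_invS hN
  have hN0 : N ≠ 0 := by
    rintro rfl
    rw [zero_smul, map_zero] at hN
    exact embed_ne_zero_vac
      (LinearPMap.graph_fst_eq_zero_snd _ (D.mem_graph_expOp_symm hN) rfl)
  exact (Submodule.smul_mem_iff _ hN0).1 h1

theorem towerS_mem_invS (s : ℝ) (n : ℕ × ℕ) : towerS (hi A B s) (vac A B s) n ∈ D.invS :=
  towerS_induction _ (fun j => hi_mem D.xS_mem_invS D.pS_mem_invS A B s j) (D.vac_mem_invS s) n

theorem phi_mem_invS (N : ℂ) (n : ℕ × ℕ) : phi A B N n ∈ D.invS.map embed :=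
  ⟨_, D.invS.smul_mem N (D.towerS_mem_invS 1 n), (phi_eq_embed A B N n).symm⟩

theorem psi_mem_invS (N : ℂ) (n : ℕ × ℕ) : psi A B N n ∈ D.invS.map embed :=
  ⟨_, D.invS.smul_mem N (D.towerS_mem_invS (-1) n), (psi_eq_embed A B N n).symm⟩

theorem bigPhi_mem_invS (n : ℕ × ℕ) : bigPhi n ∈ D.invS.map embed :=
  ⟨_, D.invS.smul_mem _ (D.towerS_mem_invS 0 n), (bigPhi_eq_embed A B n).symm⟩

theorem dense_invS : Dense (D.invS.map embed : Set Hil) := by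
  obtain ⟨e, he⟩ := exists_hilbertBasis_bigPhi
  have h1 : Dense (Submodule.span ℂ (Set.range e) : Set Hil) :=
    Submodule.dense_iff_topologicalClosure_eq_top.2 e.dense_span
  refine h1.mono (Submodule.span_le.2 ?_)
  rintro _ ⟨n, rfl⟩
  rw [he]
  exact D.bigPhi_mem_invS n

theorem invS_le_domain (t : ℝ) : D.invS.map embed ≤ (D.expOp t).domain := by
  intro f hf
  obtain ⟨g, -, hg⟩ := D.stableUnder_expOp t f hf
  exact LinearPMap.mem_domain_of_mem_graph hg

/-! ### Unboundedness -/

theorem c_ne_zero (h : A ≠ 0 ∨ B ≠ 0) : D.c ≠ 0 := by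
  intro hc
  have h1 := D.xd_mul
  have h2 := D.pd_mul
  rw [hc] at h1 h2
  simp at h1 h2
  tauto

theorem not_bounded_expOp (h : A ≠ 0 ∨ B ≠ 0) :
    ¬ ∃ M : ℝ, ∀ f : (D.expOp 1).domain, ‖D.expOp 1 f‖ ≤ M * ‖f‖ := by
  rintro ⟨M, hM⟩
  have hc := D.c_ne_zero h
  have hcont : Continuous fun y => Real.exp (1 * D.mult y) :=
    Real.continuous_exp.comp (continuous_const.mul D.continuous_mult)
  -- At y₀ the weight equals |M| + 2, so near y₀ it lies between |M| + 1 and |M| + 3. The lower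
  -- bound contradicts M on the indicator of a neighbourhood; the upper bound puts it in the domain.
  set y₀ : Plane := EuclideanSpace.single 0 (Real.log (|M| + 2) / D.c) with hy₀
  have hy₀' : Real.exp (1 * D.mult y₀) = |M| + 2 := by
    have : D.mult y₀ = Real.log (|M| + 2) := by
      simp [mult, hy₀]
      field_simp
    rw [one_mul, this, Real.exp_log (by positivity)]
  set s : Set Plane := ({y | |M| + 1 < Real.exp (1 * D.mult y)} ∩
    {y | Real.exp (1 * D.mult y) < |M| + 3}) ∩ Metric.ball y₀ 1
  have hso : IsOpen s := ((isOpen_lt continuous_const hcont).inter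
    (isOpen_lt hcont continuous_const)).inter Metric.isOpen_ball
  have hs0 : 0 < volume s := hso.measure_pos volume ⟨y₀, ⟨by
    simp only [Set.mem_ofPred_eq, hy₀']; linarith, by
    simp only [Set.mem_ofPred_eq, hy₀']; linarith⟩, Metric.mem_ball_self one_pos⟩
  have hst : volume s ≠ ⊤ :=
    ((measure_mono Set.inter_subset_right).trans_lt measure_ball_lt_top).ne
  set u : Hil := indicatorConstLp 2 hso.measurableSet hst (1 : ℂ)
  have hu : ∀ᵐ y, u y = s.indicator (fun _ => (1 : ℂ)) y := indicatorConstLp_coeFn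
  have hv := memLp_bounded_mul (μ := volume) (D.measurable_exp_mult 1) hso.measurableSet
    (C := |M| + 3) (fun y hy => by rw [Real.abs_exp]; exact hy.1.2.le) u
  have hv' : hv.toLp _ =ᵐ[volume] fun y => ((Real.exp (1 * D.mult y) : ℝ) : ℂ) * u y := by
    filter_upwards [hv.coeFn_toLp, hu] with y h1 h2
    rw [h1]
    by_cases hy : y ∈ s
    · rw [Set.indicator_of_mem hy]
    · rw [Set.indicator_of_notMem hy, h2, Set.indicator_of_notMem hy, mul_zero]
  have hgraph : (D.U.symm u, D.U.symm (hv.toLp _)) ∈ (D.expOp 1).graph := by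
    rw [mem_graph_expOp_iff, D.U.apply_symm_apply, D.U.apply_symm_apply]
    exact hv'
  obtain ⟨x, hx1, hx2⟩ := (LinearPMap.mem_graph_iff _).1 hgraph
  have hb := hM x
  rw [hx2, Submodule.coe_norm, hx1, D.U.symm.norm_map, D.U.symm.norm_map] at hb
  have hlow : (|M| + 1) * ‖u‖ ≤ ‖hv.toLp _‖ := by
    rw [← le_div_iff₀' (by positivity), div_eq_inv_mul]
    refine Lp.norm_le_mul_norm_of_ae_le_mul ?_
    filter_upwards [hv', hu] with y h1 h2
    rw [h1, inv_mul_eq_div, le_div_iff₀' (by positivity), norm_mul, Complex.norm_real,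
      Real.norm_eq_abs, Real.abs_exp]
    by_cases hy : y ∈ s
    · exact mul_le_mul_of_nonneg_right hy.1.1.le (norm_nonneg _)
    · rw [h2, Set.indicator_of_notMem hy]
      simp
  have hu0 : 0 < ‖u‖ := by
    rw [norm_indicatorConstLp (by norm_num) (by norm_num), norm_one, one_mul]
    exact Real.rpow_pos_of_pos (ENNReal.toReal_pos hs0.ne' hst) _
  nlinarith [le_abs_self M]

end Diagonalization

/-! ### The vectors of the two families -/

theorem phi_mul (A B : ℝ) (c N : ℂ) (n : ℕ × ℕ) : phi A B (c * N) n = c • phi A B N n := by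
  rw [phi_eq_embed, phi_eq_embed, mul_smul, map_smul]

theorem psi_mul (A B : ℝ) (c N : ℂ) (n : ℕ × ℕ) : psi A B (c * N) n = c • psi A B N n := by
  rw [psi_eq_embed, psi_eq_embed, mul_smul, map_smul]

theorem phi_mem_schwartz (A B : ℝ) (N : ℂ) (n : ℕ × ℕ) : phi A B N n ∈ schwartz :=
  ⟨_, (phi_eq_embed A B N n).symm⟩

theorem psi_mem_schwartz (A B : ℝ) (N : ℂ) (n : ℕ × ℕ) : psi A B N n ∈ schwartz :=
  ⟨_, (psi_eq_embed A B N n).symm⟩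

theorem mem_graph_aOp_phi_zero (A B : ℝ) (N : ℂ) (j : Fin 2) :
    (phi A B N 0, 0) ∈ (aOp A B j).graph := by
  have h := mem_graph_aOp A B j (N • vac A B 1)
  rwa [map_smul (lo A B 1 j), lo_vac, smul_zero, map_zero, ← towerS_zero (hi A B 1) (vac A B 1),
    ← phi_eq_embed] at h

theorem mem_graph_bOp_adjoint_psi_zero (A B : ℝ) (N : ℂ) (j : Fin 2) :
    (psi A B N 0, 0) ∈ ((bOp A B j)†).graph := by
  have h := mem_graph_bOp_adjoint A B j (N • vac A B (-1))
  rwa [map_smul (lo A B (-1) j), lo_vac, smul_zero, map_zero,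
    ← towerS_zero (hi A B (-1)) (vac A B (-1)), ← psi_eq_embed] at h

theorem mem_graph_cOp_bigPhi_zero (j : Fin 2) : (bigPhi 0, 0) ∈ (cOp j).graph := by
  have h := mem_graph_cOp 0 0 j ((1 / (√Real.pi : ℝ) : ℂ) • vac 0 0 0)
  rwa [map_smul (lo 0 0 0 j), lo_vac, smul_zero, map_zero, ← towerS_zero (hi 0 0 0) (vac 0 0 0),
    ← bigPhi_eq_embed] at h

namespace Diagonalization

variable {A B : ℝ} (D : Diagonalization A B)

theorem exists_mem_graph_expOp_towerS (t : ℝ) : ∃ N : ℂ, ∀ n,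
    (bigPhi n, embed (N • towerS (hi A B t) (vac A B t) n)) ∈ (D.expOp t).graph := by
  obtain ⟨N, hN⟩ := D.exists_mem_graph_expOp_vac t
  refine ⟨(1 / (√Real.pi : ℝ) : ℂ) * N, fun n => ?_⟩
  have h := D.mem_graph_expOp_smul (1 / (√Real.pi : ℝ) : ℂ) (D.mem_graph_expOp_towerS hN 0 n)
  rwa [zero_add, towerS_smul, smul_smul, ← bigPhi_eq_embed] at h

/-- The constants for which `φ_n = e^K Φ_n` and `Ψ_n = e^{-K} Φ_n`. -/
theorem exists_normalization : ∃ N N' : ℂ, inner ℂ (phi A B N 0) (psi A B N' 0) = 1 ∧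
    ∀ n, (bigPhi n, phi A B N n) ∈ (D.expOp 1).graph ∧
      (bigPhi n, psi A B N' n) ∈ (D.expOp (-1)).graph := by
  obtain ⟨N, hN⟩ := D.exists_mem_graph_expOp_towerS 1
  obtain ⟨N', hN'⟩ := D.exists_mem_graph_expOp_towerS (-1)
  simp only [← phi_eq_embed, ← psi_eq_embed] at hN hN'
  refine ⟨N, N', ?_, fun n => ⟨hN n, hN' n⟩⟩
  -- The normalisation is automatic: ⟨TΦ₀, T⁻¹Φ₀⟩ = ‖Φ₀‖² = 1.
  rw [D.inner_expOp_comm (D.mem_graph_expOp_neg_iff.1 (hN' 0)) (hN 0), inner_self_eq_norm_sq_to_K,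
    orthonormal_bigPhi.1]
  simp

/-- The sums of a quasi basis, for families obtained from an orthonormal basis. -/
theorem hasSum_inner_mul_inner {t : ℝ} {φ ψ : ℕ × ℕ → Hil}
    (hφ : ∀ n, (bigPhi n, φ n) ∈ (D.expOp t).graph)
    (hψ : ∀ n, (bigPhi n, ψ n) ∈ (D.expOp (-t)).graph) {f g : Hil}
    (hf : f ∈ (D.expOp t).domain) (hg : g ∈ (D.expOp (-t)).domain) :
    HasSum (fun n => inner ℂ f (φ n) * inner ℂ (ψ n) g) (inner ℂ f g) := by
  obtain ⟨e, he⟩ := exists_hilbertBasis_bigPhi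
  have hf' := (D.expOp t).mem_graph ⟨f, hf⟩
  have hg' := (D.expOp (-t)).mem_graph ⟨g, hg⟩
  -- Parseval for e^{tK}f and e^{-tK}g: symmetry moves the exponentials onto the basis vectors in
  -- each term, and they cancel in ⟨e^{tK}f, e^{-tK}g⟩ = ⟨f, g⟩.
  have key := e.hasSum_inner_mul_inner (D.expOp t ⟨f, hf⟩) (D.expOp (-t) ⟨g, hg⟩)
  rw [D.inner_expOp_comm (D.mem_graph_expOp_neg_iff.1 hg') hf'] at key
  refine key.congr_fun fun n => ?_
  rw [he, D.inner_expOp_comm (hφ n) hf', D.inner_expOp_comm hg' (hψ n)]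

theorem isQuasiBases {N N' : ℂ} (h : inner ℂ (phi A B N 0) (psi A B N' 0) = 1) :
    IsQuasiBases ((D.expOp 1).domain ⊓ (D.expOp (-1)).domain) (phi A B N) (psi A B N') := by
  have hle : D.invS.map embed ≤ (D.expOp 1).domain ⊓ (D.expOp (-1)).domain :=
    le_inf (D.invS_le_domain 1) (D.invS_le_domain (-1))
  obtain ⟨N₀, N₀', h₀, hT⟩ := D.exists_normalization
  have hN₀ : N₀ ≠ 0 := by
    rintro rfl
    rw [phi_eq_embed, zero_smul, map_zero, inner_zero_left] at h₀
    exact zero_ne_one h₀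
  have hN₀' : N₀' ≠ 0 := by
    rintro rfl
    rw [psi_eq_embed, zero_smul, map_zero, inner_zero_right] at h₀
    exact zero_ne_one h₀
  -- Any admissible constants differ from the special ones by factors with c̄ c' = 1, and each term
  -- of the two sums is multiplied by c c̄' or c̄ c', both equal to 1.
  obtain ⟨c, rfl⟩ : ∃ c, N = c * N₀ := ⟨N / N₀, (div_mul_cancel₀ _ hN₀).symm⟩
  obtain ⟨c', rfl⟩ : ∃ c', N' = c' * N₀' := ⟨N' / N₀', (div_mul_cancel₀ _ hN₀').symm⟩
  have hc : starRingEnd ℂ c * c' = 1 := by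
    rwa [phi_mul, psi_mul, inner_smul_left, inner_smul_right, h₀, mul_one] at h
  have hc' : c * starRingEnd ℂ c' = 1 := by simpa using congrArg (starRingEnd ℂ) hc
  refine ⟨D.dense_invS.mono hle, fun n => hle (D.phi_mem_invS _ n),
    fun n => hle (D.psi_mem_invS _ n), fun f hf g hg => ?_, fun f hf g hg => ?_⟩
  · refine (D.hasSum_inner_mul_inner (fun n => (hT n).1) (fun n => (hT n).2)
      hf.1 hg.2).congr_fun fun n => ?_
    rw [phi_mul, psi_mul, inner_smul_left, inner_smul_right]
    linear_combination (inner ℂ f (phi A B N₀ n) * inner ℂ (psi A B N₀' n) g) * hc'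
  · refine (D.hasSum_inner_mul_inner (t := -1) (fun n => (hT n).2)
      (fun n => by rw [neg_neg]; exact (hT n).1) hf.2 (by rw [neg_neg]; exact hg.1)).congr_fun
      fun n => ?_
    rw [phi_mul, psi_mul, inner_smul_left, inner_smul_right]
    linear_combination (inner ℂ f (psi A B N₀' n) * inner ℂ (phi A B N₀ n) g) * hc

/-! ### Intertwining relations -/

theorem intertwines_of_mem_graph {t : ℝ} {L M : Hil →ₗ.[ℂ] Hil} {f g u v : Hil}
    (hfg : (f, g) ∈ (D.expOp t).graph) (hL : (f, u) ∈ L.graph) (hM : (g, v) ∈ M.graph)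
    (huv : (u, v) ∈ (D.expOp t).graph) : Intertwines (D.expOp t) L M f :=
  ⟨u, hL, mem_graph_opMul_iff.2 ⟨v, mem_graph_opMul_iff.2 ⟨g, hfg, hM⟩,
    (mem_graph_inverse_iff (D.ker_expOp t)).2 huv⟩⟩

theorem intertwines_aOp {f g : 𝓢(Plane, ℂ)} (hfg : (embed f, embed g) ∈ (D.expOp (-2)).graph)
    (j : Fin 2) : Intertwines (D.expOp (-2)) (aOp A B j) (bOp A B j)† (embed f) := by
  have h := D.mem_graph_expOp_lo hfg 1 j
  rw [show (1 : ℝ) + -2 = -1 by norm_num] at h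
  exact D.intertwines_of_mem_graph hfg (mem_graph_aOp A B j f) (mem_graph_bOp_adjoint A B j g) h

/-- Θ = e^{-2K} lowers the shift from 1 to -1 in both factors, turning b_j a_j into a_j† b_j†, which
is N_j† on Schwartz functions. -/
theorem intertwines_num {f g : 𝓢(Plane, ℂ)} (hfg : (embed f, embed g) ∈ (D.expOp (-2)).graph)
    (j : Fin 2) : Intertwines (D.expOp (-2)) (num A B j) (num A B j)† (embed f) := by
  have h := D.mem_graph_expOp_hi (D.mem_graph_expOp_lo hfg 1 j) 1 j
  rw [show (1 : ℝ) + -2 = -1 by norm_num] at h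
  exact D.intertwines_of_mem_graph hfg (mem_graph_num A B j f) (mem_graph_num_adjoint A B j g) h

theorem isConjugate (j : Fin 2) :
    IsConjugate (D.invS.map embed) (D.expOp (-2)) (aOp A B j) (bOp A B j)† where
  selfAdjoint := D.isSelfAdjoint_expOp _
  injective := D.ker_expOp _
  stable := D.stableUnder_expOp _
  stable_inv := by
    rw [inverse_expOp]
    exact D.stableUnder_expOp _
  conj := by
    rintro _ ⟨f, hf, rfl⟩
    obtain ⟨g, hg⟩ := hf (-2)
    exact D.intertwines_aOp hg j

end Diagonalization

end PB

end

open PB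

/-! ### The main theorem -/

theorem mainTheorem2 (A B : ℝ) :
    -- `a_j`, `b_j` are `𝒟`-pseudo-bosons for `𝒟 = 𝒮(ℝ²)`
    IsPseudoBosonic schwartz (aOp A B) (bOp A B) ∧
    -- the vacua and all the vectors built on them
    (∃ N N' : ℂ, inner ℂ (phi A B N 0) (psi A B N' 0) = 1) ∧
    (∀ N N' : ℂ, inner ℂ (phi A B N 0) (psi A B N' 0) = 1 →
      phi A B N 0 ≠ 0 ∧ psi A B N' 0 ≠ 0 ∧
      (∀ j, (phi A B N 0, 0) ∈ (aOp A B j).graph ∧ (psi A B N' 0, 0) ∈ ((bOp A B j)†).graph) ∧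
      (∀ n, phi A B N n ∈ schwartz ∧ psi A B N' n ∈ schwartz)) ∧
    -- `H = N₁ + N₂ + (A² + B² + 1) 𝟙` on `𝒟`
    (∀ f ∈ schwartz, ∃ g, (f, g) ∈ (hamiltonian A B).graph ∧
      (f, g) ∈ (num A B 0 + num A B 1 + scalarOp ((A : ℂ) ^ 2 + (B : ℂ) ^ 2 + 1)).graph) ∧
    -- the oscillator eigenfunctions
    (∀ j, (bigPhi 0, 0) ∈ (cOp j).graph) ∧
    (∃ e : HilbertBasis (ℕ × ℕ) ℂ Hil, ∀ n, e n = bigPhi n) ∧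
    -- `T = e^{-A(p₁+p₂)+B(x₁+x₂)}`
    ∃ T : Hil →ₗ.[ℂ] Hil,
      IsFunctionOf Real.exp (generator A B) T ∧
      (∀ T', IsFunctionOf Real.exp (generator A B) T' → T' = T) ∧
      IsSelfAdjoint T ∧ LinearMap.ker T.toFun = ⊥ ∧ Dense (T.inverse.domain : Set Hil) ∧
      ((A ≠ 0 ∨ B ≠ 0) → ¬ ∃ M : ℝ, ∀ f : T.domain, ‖T f‖ ≤ M * ‖f‖) ∧
      -- quasi bases
      (∀ N N' : ℂ, inner ℂ (phi A B N 0) (psi A B N' 0) = 1 →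
        IsQuasiBases (T.domain ⊓ T.inverse.domain) (phi A B N) (psi A B N')) ∧
      -- `φ_n = T Φ_n`, `Ψ_n = T⁻¹ Φ_n` and `Ψ_n = Θ φ_n` with `Θ = T⁻²`
      (∃ N N' : ℂ, inner ℂ (phi A B N 0) (psi A B N' 0) = 1 ∧
        ∀ n, (bigPhi n, phi A B N n) ∈ T.graph ∧
          (bigPhi n, psi A B N' n) ∈ T.inverse.graph ∧
          (phi A B N n, psi A B N' n) ∈ (opMul T.inverse T.inverse).graph) ∧
      -- `Θ = T⁻² = e^{2A(p₁+p₂)-2B(x₁+x₂)}`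
      ∃ Θ : Hil →ₗ.[ℂ] Hil, Θ = opMul T.inverse T.inverse ∧
        IsFunctionOf Real.exp (generator (-2 * A) (-2 * B)) Θ ∧
        IsSelfAdjoint Θ ∧ LinearMap.ker Θ.toFun = ⊥ ∧
        -- `a_j f = Θ⁻¹ b_j† Θ f` and `N_j f = Θ⁻¹ N_j† Θ f` for all `f ∈ 𝒟` that `Θ` maps into `𝒟`
        (∀ f ∈ schwartz, ∀ g ∈ schwartz, (f, g) ∈ Θ.graph → ∀ j,
          Intertwines Θ (aOp A B j) (bOp A B j)† f ∧
          Intertwines Θ (num A B j) (num A B j)† f) ∧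
        -- `Θ`-conjugacy on a dense subspace of `𝒟` invariant under `Θ` and `Θ⁻¹`
        ∃ 𝒟₀ : Submodule ℂ Hil, 𝒟₀ ≤ schwartz ∧
          (∀ N n, phi A B N n ∈ 𝒟₀ ∧ psi A B N n ∈ 𝒟₀) ∧
          IsPseudoBosonic 𝒟₀ (aOp A B) (bOp A B) ∧
          ∀ j, IsConjugate 𝒟₀ Θ (aOp A B j) (bOp A B j)† := by
  obtain ⟨D⟩ := nonempty_diagonalization A B
  have hinv : (D.expOp 1).inverse = D.expOp (-1) := D.inverse_expOp 1
  have hΘ : D.expOp (-2) = opMul (D.expOp 1).inverse (D.expOp 1).inverse := by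
    rw [hinv, D.opMul_expOp]
    norm_num
  have hT : IsFunctionOf Real.exp (generator A B) (D.expOp 1) := by
    simpa only [one_mul] using D.isFunctionOf_expOp 1
  obtain ⟨N, N', hN, hNT⟩ := D.exists_normalization
  refine ⟨isPseudoBosonic_schwartz A B, ⟨N, N', hN⟩, fun N N' h => ⟨?_, ?_, fun j =>
    ⟨mem_graph_aOp_phi_zero A B N j, mem_graph_bOp_adjoint_psi_zero A B N' j⟩,
    fun n => ⟨phi_mem_schwartz A B N n, psi_mem_schwartz A B N' n⟩⟩, hamiltonian_eq_num A B,
    mem_graph_cOp_bigPhi_zero, exists_hilbertBasis_bigPhi, D.expOp 1, hT,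
    fun T' hT' => hT'.exp_unique hT, D.isSelfAdjoint_expOp 1, D.ker_expOp 1, ?_,
    D.not_bounded_expOp, fun N N' h => ?_, ⟨N, N', hN, fun n => ?_⟩, D.expOp (-2), hΘ,
    D.isFunctionOf_expOp (-2), D.isSelfAdjoint_expOp _, D.ker_expOp _, ?_,
    D.invS.map embed, LinearMap.map_le_range, fun N n => ⟨D.phi_mem_invS N n, D.psi_mem_invS N n⟩,
    isPseudoBosonic_map_embed A B D.xS_mem_invS D.pS_mem_invS D.dense_invS, D.isConjugate⟩
  · intro h0
    simp [h0] at h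
  · intro h0
    simp [h0] at h
  · rw [hinv]
    exact (D.isSelfAdjoint_expOp _).dense_domain
  · rw [hinv]
    exact D.isQuasiBases h
  -- Θφ_n = Ψ_n by the group law: e^{-K} takes φ_n back to Φ_n, and a second e^{-K} takes Φ_n to
  -- Ψ_n.
  · rw [← hΘ, hinv, show (-2 : ℝ) = -1 + -1 by norm_num]
    exact ⟨(hNT n).1, (hNT n).2,
      D.mem_graph_expOp_trans (D.mem_graph_expOp_symm (hNT n).1) (hNT n).2⟩
  · rintro _ ⟨f, rfl⟩ _ ⟨g, rfl⟩ hfg j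
    exact ⟨D.intertwines_aOp hfg j, D.intertwines_num hfg j⟩
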